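/- **Setting.** Let $\mathcal X\subseteq\mathbb R^{n_x}$, $\mathcal Y\subseteq\mathbb R^{n_y}$ be closed convex sets, $\mathcal Z=\mathcal X\times\mathcal Y$, and consider $$\min_{x\in\mathcal X}\max_{y\in\mathcal Y} f(x,y)=\frac1M\sum_{m=1}^M f_m(x,y),$$ where every $f_m$ is convex in $x$ and concave in $y$ with partial gradients on $\mathcal Z$. Put $F_m(x,y)=(\nabla_xf_m(x,y),-\nabla_yf_m(x,y))$ and $F=\frac1M\sum_mF_m$, and assume for constants $L,L_{\max},\mu>0$ and all $z_1,z_2\in\mathcal Z$ that $\|F(z_1)-F(z_2)\|\le L\|z_1-z_2\|$, $\|F_m(z_1)-F_m(z_2)\|\le L_{\max}\|z_1-z_2\|$ for every $m$, and $\langle F(z_1)-F(z_2),z_1-z_2\rangle\ge\mu\|z_1-z_2\|^2$. Let $z^*\in\mathcal Z$ be a solution (a saddle point of $f$ on $\mathcal X\times\mathcal Y$). The nodes $1,\dots,M$ communicate in round $k=0,1,2,\dots$ over a graph $\mathcal G^k$. The sequence has a connected skeleton: there is a connected graph $\hat{\mathcal G}$ on the nodes that is contained in every $\mathcal G^k$;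 all Laplacian eigenvalues of every $\mathcal G^k$ are at most $\lambda_{\max}$, and all positive Laplacian eigenvalues of $\hat{\mathcal G}$ are at least $\lambda_{\min}^+>0$. Put $\chi=\lambda_{\max}/\lambda^+_{\min}$. *Gossip (accelerated, non-recoverable links).* Given vectors $z_1,\dots,z_M$, a number $H$ and the number $k_0$ of the current round, set $u_i^0=z_i^0=z_i$ and let $\mathcal N_i$ be the neighbours of $i$ in $\mathcal G^{k_0}$; for $k=0,\dots,H-1$ remove from $\mathcal N_i$ all nodes that are not neighbours of $i$ in $\mathcal G^{k_0+k}$, and set $$u_i^{k+1}=z_i^k-\eta\Big(|\mathcal N_i|z_i^k-\sum_{j\in\mathcal N_i}z_j^k\Big),\qquad z_i^{k+1}=(1+\beta)u_i^{k+1}-\beta u_i^k,$$ with $\eta=1/\lambda_{\max}$, $\beta=(\sqrt\chi-1)/(\sqrt\chi+1)$. The output is $z_1^H,\dots,z_M^H$; this takes $H$ communication rounds. *Method.* Start from $z_m^0=z^0\in\mathcal Z$ for all $m$. In each of $N$ iterations, run gossip with $H$ steps on the vectors $z_m^k-\gamma F_m(z_m^k)$ and project the outputs onto $\mathcal Z$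 to get $z_m^{k+1/2}$; then run gossip with $H$ steps on $z_m^k-\gamma F_m(z_m^{k+1/2})$ and project the outputs onto $\mathcal Z$ to get $z_m^{k+1}$. A local computation is an evaluation of $F_m$ by node $m$. Write $\bar z^N=\frac1M\sum_mz_m^N$. The vectors $z_1^N,\dots,z_M^N$ form an $\varepsilon$-solution if $\|\bar z^N-z^*\|^2\le\varepsilon$ and $\frac1M\sum_m\|z_m^N-\bar z^N\|^2\le\varepsilon$. Let $Q^2=\frac1M\sum_m\|F_m(z^*)\|^2$ and $$a=\log\big(2+\|z^0-z^*\|^2\big),\qquad b=\log\Big(2+\|z^0-z^*\|^2+\frac{Q^2}{L_{\max}^2}+\frac{L_{\max}}{\mu}\Big).$$ **Claim.** There is an absolute constant $C>0$ such that in this setting, for every $0<\varepsilon\le\frac12$: 1. for all step sizes $0<\gamma\le\frac1{4L}$ and all integers $H\ge C\,b\,\sqrt\chi\,\max\{1,\log\chi\}\log\frac1\varepsilon$ and $N\ge C\,a\,\frac1{\gamma\mu}\log\frac1\varepsilon$, the method returns an $\varepsilon$-solution after $N$ iterations; 2. for $\gamma=\frac1{4L}$ there are $H\le C\,b\,\sqrt\chi\,\max\{1,\log\chi\}\log\frac1\varepsilon$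 and $N$ such that the method returns an $\varepsilon$-solution after $N$ iterations, using at most $$C\,a\,b\,\sqrt\chi\,\max\{1,\log\chi\}\,\frac L\mu\log^2\frac1\varepsilon$$ communication rounds and at most $C\,a\,\frac L\mu\log\frac1\varepsilon$ local computations on each node. That is, up to factors that are logarithmic in the problem data, $H=O(\sqrt\chi\log\chi\log\frac1\varepsilon)$, with $O(\sqrt\chi\log\chi\,\frac L\mu\log^2\frac1\varepsilon)$ communication rounds and $O(\frac L\mu\log\frac1\varepsilon)$ local computations per node. -/

import Mathlib

namespace MinMaxGossip

noncomputable section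

/-- The space `ℝ^{n_x} × ℝ^{n_y}` of pairs `z = (x, y)` with its Euclidean norm. -/
abbrev Pt (nx ny : ℕ) : Type :=
  WithLp 2 (EuclideanSpace ℝ (Fin nx) × EuclideanSpace ℝ (Fin ny))

/-- Arithmetic mean of the vectors held by the `M` nodes. -/
def mean {M : ℕ} {E : Type*} [AddCommGroup E] [Module ℝ E] (z : Fin M → E) : E :=
  (M : ℝ)⁻¹ • ∑ m, z m

/-! ### The saddle point problem -/

/-- Data of `min_{x ∈ X} max_{y ∈ Y} (1/M) ∑ m, f_m(x, y)`. -/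
structure SaddleProblem (M nx ny : ℕ) where
  X : Set (EuclideanSpace ℝ (Fin nx))
  Y : Set (EuclideanSpace ℝ (Fin ny))
  f : Fin M → EuclideanSpace ℝ (Fin nx) → EuclideanSpace ℝ (Fin ny) → ℝ

namespace SaddleProblem

variable {M nx ny : ℕ} (P : SaddleProblem M nx ny)

/-- `Z = X × Y`. -/
def Z : Set (Pt nx ny) := {z | z.fst ∈ P.X ∧ z.snd ∈ P.Y}

/-- The global objective `f = (1/M) ∑ m, f_m`. -/
def obj (x : EuclideanSpace ℝ (Fin nx)) (y : EuclideanSpace ℝ (Fin ny)) : ℝ :=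
  (M : ℝ)⁻¹ * ∑ m, P.f m x y

/-- The local operator `F_m(x, y) = (∇_x f_m(x, y), -∇_y f_m(x, y))`. -/
def F (m : Fin M) (z : Pt nx ny) : Pt nx ny :=
  WithLp.toLp 2
    (gradient (fun x => P.f m x z.snd) z.fst, -gradient (fun y => P.f m z.fst y) z.snd)

/-- The global operator `F = (1/M) ∑ m, F_m`. -/
def Fbar (z : Pt nx ny) : Pt nx ny := mean fun m => P.F m z

/-- Standing assumptions: closed convex constraint sets, functions convex in `x` and concave in
`y` whose partial gradients exist on `Z`; `f` is `L`-smooth, every `f_m` is `Lmax`-smooth, and `f`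
is `μ`-strongly-convex-strongly-concave. -/
structure Regular (L Lmax μ : ℝ) : Prop where
  L_pos : 0 < L
  Lmax_pos : 0 < Lmax
  mu_pos : 0 < μ
  closed_X : IsClosed P.X
  closed_Y : IsClosed P.Y
  convex_X : Convex ℝ P.X
  convex_Y : Convex ℝ P.Y
  convex_f : ∀ m, ∀ y ∈ P.Y, ConvexOn ℝ P.X fun x => P.f m x y
  concave_f : ∀ m, ∀ x ∈ P.X, ConcaveOn ℝ P.Y fun y => P.f m x y
  diff_x : ∀ m, ∀ x ∈ P.X, ∀ y ∈ P.Y, DifferentiableAt ℝ (fun x' => P.f m x' y) x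
  diff_y : ∀ m, ∀ x ∈ P.X, ∀ y ∈ P.Y, DifferentiableAt ℝ (fun y' => P.f m x y') y
  smooth : ∀ z₁ ∈ P.Z, ∀ z₂ ∈ P.Z, ‖P.Fbar z₁ - P.Fbar z₂‖ ≤ L * ‖z₁ - z₂‖
  smooth_local : ∀ m, ∀ z₁ ∈ P.Z, ∀ z₂ ∈ P.Z, ‖P.F m z₁ - P.F m z₂‖ ≤ Lmax * ‖z₁ - z₂‖
  strong : ∀ z₁ ∈ P.Z, ∀ z₂ ∈ P.Z,
    μ * ‖z₁ - z₂‖ ^ 2 ≤ inner ℝ (P.Fbar z₁ - P.Fbar z₂) (z₁ - z₂)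

/-- `z* = (x*, y*)` is a solution, i.e. a saddle point of `f` on `X × Y`. -/
def IsSolution (zs : Pt nx ny) : Prop :=
  zs ∈ P.Z ∧ ∀ x ∈ P.X, ∀ y ∈ P.Y,
    P.obj zs.fst y ≤ P.obj zs.fst zs.snd ∧ P.obj zs.fst zs.snd ≤ P.obj x zs.snd

end SaddleProblem

/-- The local vectors `z_1, …, z_M` form an `ε`-solution: their mean is within squared distance `ε`
of `z*`, and they agree with their mean up to mean squared error `ε`. -/
def IsEpsSolution {M nx ny : ℕ} (zs : Pt nx ny) (ε : ℝ) (z : Fin M → Pt nx ny) : Prop :=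
  ‖mean z - zs‖ ^ 2 ≤ ε ∧ (M : ℝ)⁻¹ * ∑ m, ‖z m - mean z‖ ^ 2 ≤ ε

/-! ### The time-varying network -/

open scoped Classical in
/-- `t` is an eigenvalue of the graph Laplacian of `G`. -/
def IsLapEigenvalue {M : ℕ} (G : SimpleGraph (Fin M)) (t : ℝ) : Prop :=
  Module.End.HasEigenvalue (Matrix.toLin' (G.lapMatrix ℝ)) t

/-- The graphs `G 0, G 1, …` contain a common connected graph `Ghat`; the largest Laplacian
eigenvalue of each `G k` is at most `lmax`, and the smallest positive Laplacian eigenvalue of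
`Ghat` is at least `lmin > 0`. -/
def HasConnectedSkeleton {M : ℕ} (G : ℕ → SimpleGraph (Fin M)) (lmin lmax : ℝ) : Prop :=
  0 < lmin ∧ ∃ Ghat : SimpleGraph (Fin M), Ghat.Connected ∧ (∀ k, Ghat ≤ G k) ∧
    (∀ k t, IsLapEigenvalue (G k) t → t ≤ lmax) ∧
    (∀ t, 0 < t → IsLapEigenvalue Ghat t → lmin ≤ t)

open scoped Classical in
/-- Neighbours of node `i` in `G`. -/
def nbrs {M : ℕ} (G : SimpleGraph (Fin M)) (i : Fin M) : Finset (Fin M) :=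
  Finset.univ.filter fun j => G.Adj i j

/-! ### Accelerated gossip with non-recoverable links -/

/-- State of the gossip procedure: the links still in use, the two vectors of every node, and the
number of the next communication round. -/
structure GossipState (M : ℕ) (E : Type*) where
  links : Fin M → Finset (Fin M)
  u : Fin M → E
  z : Fin M → E
  round : ℕ

section Algorithms

variable {M : ℕ} {E : Type*} [NormedAddCommGroup E] [InnerProductSpace ℝ E]

/-- Initialization in communication round `k₀`. -/
def gossipInit (G : ℕ → SimpleGraph (Fin M)) (k₀ : ℕ) (z : Fin M → E) : GossipState M E where
  links := nbrs (G k₀)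
  u := z
  z := z
  round := k₀

/-- One iteration: a link that is absent in the current round is dropped, and every node
exchanges its vector once along its remaining links. -/
def gossipStep (G : ℕ → SimpleGraph (Fin M)) (η β : ℝ) (s : GossipState M E) :
    GossipState M E :=
  let N : Fin M → Finset (Fin M) := fun i => s.links i ∩ nbrs (G s.round) i
  let u' : Fin M → E := fun i => s.z i - η • (((N i).card : ℝ) • s.z i - ∑ j ∈ N i, s.z j)
  { links := N
    u := u'
    z := fun i => (1 + β) • u' i - β • s.u i
    round := s.round + 1 }

/-- `H` iterations started from the vectors `z` in round `k₀`. -/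
def accGossip (G : ℕ → SimpleGraph (Fin M)) (η β : ℝ) (H k₀ : ℕ) (z : Fin M → E) :
    GossipState M E :=
  (gossipStep G η β)^[H] (gossipInit G k₀ z)

/-! ### The decentralized extragradient method -/

/-- `w` is a nearest point to `z` in `S`. -/
def IsProj (S : Set E) (z w : E) : Prop := w ∈ S ∧ ∀ v ∈ S, ‖z - w‖ ≤ ‖z - v‖

/-- Euclidean projection onto `S` (used for non-empty closed convex sets, where the nearest point
exists and is unique). -/
def proj (S : Set E) (z : E) : E := Classical.epsilon (IsProj S z)

theorem proj_spec {S : Set E} (hne : S.Nonempty) (hc : IsComplete S) (hconv : Convex ℝ S)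
    (z : E) : IsProj S z (proj S z) := by
  refine Classical.epsilon_spec (p := IsProj S z) ?_
  obtain ⟨w, hw, h⟩ := exists_norm_eq_iInf_of_complete_convex hne hc hconv z
  refine ⟨w, hw, fun v hv => ?_⟩
  rw [h]
  exact ciInf_le ⟨0, by rintro _ ⟨x, rfl⟩; exact norm_nonneg _⟩ (⟨v, hv⟩ : S)

/-- State of the method: the vectors of the nodes, the number of communication rounds used so far,
and the number of evaluations of its own operator `F_m` that each node has made. -/
structure MethodState (M : ℕ) (E : Type*) where
  z : Fin M → E
  rounds : ℕ
  calls : ℕ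

/-- One iteration of the extragradient method: two operator evaluations on each node, each
followed by a call of the gossip procedure and a projection. -/
def methodStep (Z : Set E) (F : Fin M → E → E) (G : ℕ → SimpleGraph (Fin M)) (η β γ : ℝ) (H : ℕ)
    (s : MethodState M E) : MethodState M E :=
  let g₁ := accGossip G η β H s.rounds fun m => s.z m - γ • F m (s.z m)
  let half : Fin M → E := fun m => proj Z (g₁.z m)
  let g₂ := accGossip G η β H g₁.round fun m => s.z m - γ • F m (half m)
  { z := fun m => proj Z (g₂.z m)
    rounds := g₂.round
    calls := s.calls + 2 }

/-- `N` iterations started from the common point `z₀`. -/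
def method (Z : Set E) (F : Fin M → E → E) (G : ℕ → SimpleGraph (Fin M)) (η β γ : ℝ) (H : ℕ)
    (z₀ : E) (N : ℕ) : MethodState M E :=
  (methodStep Z F G η β γ H)^[N] { z := fun _ => z₀, rounds := 0, calls := 0 }

end Algorithms

/-- The method for the problem `P` with the gossip parameters `η = 1/lmax` and
`β = (√χ - 1)/(√χ + 1)`, where `χ = lmax/lmin`. -/
def desm {M nx ny : ℕ} (P : SaddleProblem M nx ny) (G : ℕ → SimpleGraph (Fin M))
    (lmin lmax γ : ℝ) (H : ℕ) (z₀ : Pt nx ny) (N : ℕ) : MethodState M (Pt nx ny) :=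
  method P.Z P.F G (1 / lmax)
    ((Real.sqrt (lmax / lmin) - 1) / (Real.sqrt (lmax / lmin) + 1)) γ H z₀ N

end

end MinMaxGossip

/-! The mean of the local vectors follows an exact extragradient step up to errors caused by
disagreement between the nodes, and gossip makes the disagreement small.

Gossip preserves the mean, and on the deviations from the mean it is Nesterov's method for the
quadratic form of the Laplacian (`nesterov_step`). That form is a sum of squares over edges, hence
monotone in the graph. Since a dropped link never returns, each change of graph can only lower the
Lyapunov function. The skeleton gives the lower curvature bound `lmin`, the first graph of the phase
the upper bound `lmax`. So `H` steps multiply the squared deviation by at most `(χ + 1) (1 - 1/√χ) ^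
H` (`norm_dev_accGossip_sq_le`).

Let `r` be the distance from the mean to `zs`, `d` the root mean square disagreement and `s = γ
Lmax`. `decentralized_step` compares an iteration with the exact step started at the mean, which
contracts `r` by `1 - γμ/2` (`extragradient_contraction`); projections are nonexpansive, so they do
not amplify the errors. In the weighted sum `r + (1 + s) d` the disagreement is absorbed
(`potential_step`), which yields linear convergence up to a term proportional to the gossip factor
`ρ` (`method_error_le`). Logarithmic lower bounds on `H` and `N` make each of the two remaining
terms at most `√ε / 2`. -/

namespace MinMaxGossip

/-! ### Accelerated gradient step for a quadratic form -/

section Nesterov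

variable {V : Type*} [NormedAddCommGroup V] [InnerProductSpace ℝ V]

/-- One step of Nesterov's method for `½⟪A x, x⟫` contracts the Lyapunov function
`½⟪A x, x⟫ + (μ/2) ‖v‖²` by the factor `1 - q`, `q = √(μ/Λ)`. -/
theorem nesterov_step (A : V →ₗ[ℝ] V) (hsym : ∀ x y, inner ℝ (A x) y = inner ℝ x (A y))
    (hpos : ∀ x, 0 ≤ inner ℝ (A x) x) {Λ μ q : ℝ} (hΛ : 0 < Λ) (hq : 0 < q)
    (hq1 : q ≤ 1) (hqΛ : q ^ 2 * Λ = μ) (hupper : ∀ x, inner ℝ (A x) x ≤ Λ * ‖x‖ ^ 2)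
    {x y v : V} (hlower : μ * ‖y‖ ^ 2 ≤ inner ℝ (A y) y) (hy : (1 + q) • y = x + q • v) :
    (1 / 2) * inner ℝ (A (y - Λ⁻¹ • A y)) (y - Λ⁻¹ • A y) +
        μ / 2 * ‖(1 - q) • v + q • y - (q / μ) • A y‖ ^ 2 ≤
      (1 - q) * ((1 / 2) * inner ℝ (A x) x + μ / 2 * ‖v‖ ^ 2) := by
  have hμ : 0 < μ := by rw [← hqΛ]; positivity
  have hx : x = (1 + q) • y - q • v := by rw [hy]; simp
  set g := A y with hg
  have h1 := hupper g
  have h2 := hpos (y - x)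
  have e1 : inner ℝ (A (y - Λ⁻¹ • g)) (y - Λ⁻¹ • g) =
      inner ℝ g y - 2 * Λ⁻¹ * ‖g‖ ^ 2 + Λ⁻¹ ^ 2 * inner ℝ (A g) g := by
    simp only [map_sub, map_smul, inner_sub_left, inner_sub_right, real_inner_smul_left,
      real_inner_smul_right]
    rw [hsym g y, ← hg, real_inner_self_eq_norm_sq]
    ring
  have e2 : inner ℝ (A (y - x)) (y - x) = inner ℝ g y - 2 * inner ℝ g x + inner ℝ (A x) x := by
    simp only [map_sub, inner_sub_left, inner_sub_right]
    rw [hsym x y, ← hg, real_inner_comm g x]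
    ring
  have e3 : ‖(1 - q) • v + q • y - (q / μ) • g‖ ^ 2 = ‖(1 - q) • v + q • y‖ ^ 2
      - 2 * (q / μ) * inner ℝ ((1 - q) • v + q • y) g + (q / μ) ^ 2 * ‖g‖ ^ 2 := by
    rw [norm_sub_sq_real, real_inner_smul_right, norm_smul, mul_pow, Real.norm_eq_abs, sq_abs]
    ring
  have e4 : ‖(1 - q) • v + q • y‖ ^ 2 =
      (1 - q) * ‖v‖ ^ 2 + q * ‖y‖ ^ 2 - q * (1 - q) * ‖v - y‖ ^ 2 := by
    rw [norm_add_sq_real, norm_sub_sq_real]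
    simp only [real_inner_smul_left, real_inner_smul_right, norm_smul, mul_pow, Real.norm_eq_abs,
      sq_abs]
    ring
  -- Eliminating `x` through `hy` turns the cross term of the expanded square into values of the
  -- form at `x` and `y`.
  have e5 : inner ℝ ((1 - q) • v + q • y) g * q = inner ℝ g y - (1 - q) * inner ℝ g x := by
    rw [hx]
    simp only [inner_sub_right, inner_add_left, real_inner_smul_left, real_inner_smul_right]
    rw [real_inner_comm g y, real_inner_comm g v]
    ring
  -- The choice `q ^ 2 * Λ = μ` makes this term cancel the decrease of the form in the gradient
  -- step. What is left over is `h3` (convexity of the squared norm), `h4` (strong convexity, needed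
  -- at `y` only) and `h5` (convexity between `x` and `y`).
  have e6 : μ / 2 * ((q / μ) ^ 2 * ‖g‖ ^ 2) = Λ⁻¹ / 2 * ‖g‖ ^ 2 := by
    rw [← hqΛ]; field_simp
  have e7 : μ / 2 * (2 * (q / μ) * inner ℝ ((1 - q) • v + q • y) g) =
      inner ℝ g y - (1 - q) * inner ℝ g x := by
    rw [← e5]; field_simp
  have e8 : Λ⁻¹ ^ 2 * inner ℝ (A g) g ≤ Λ⁻¹ * ‖g‖ ^ 2 := by
    calc Λ⁻¹ ^ 2 * inner ℝ (A g) g ≤ Λ⁻¹ ^ 2 * (Λ * ‖g‖ ^ 2) := by gcongr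
      _ = Λ⁻¹ * ‖g‖ ^ 2 := by field_simp
  have h3 : 0 ≤ μ / 2 * (q * (1 - q) * ‖v - y‖ ^ 2) := by
    have : 0 ≤ 1 - q := by linarith
    positivity
  have h4 : 0 ≤ q * (inner ℝ g y - μ * ‖y‖ ^ 2) := by
    apply mul_nonneg hq.le; linarith
  have h5 : 0 ≤ (1 - q) * inner ℝ (A (y - x)) (y - x) := mul_nonneg (by linarith) h2
  rw [e2] at h5
  rw [e1, e3, e4]
  nlinarith [e6, e7, e8, h3, h4, h5]

end Nesterov

/-! ### The graph Laplacian acting on vectors -/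

section Laplacian

variable {M : ℕ} {E : Type*} [NormedAddCommGroup E] [InnerProductSpace ℝ E]

/-- The vectors held by all nodes, with the Euclidean norm. -/
abbrev Stack (M : ℕ) (E : Type*) : Type _ := PiLp 2 fun _ : Fin M => E

/-- The graph Laplacian acting on the vectors held by the nodes. -/
noncomputable def lapOp (G : SimpleGraph (Fin M)) : Stack M E →ₗ[ℝ] Stack M E where
  toFun z := WithLp.toLp 2 fun i => ((nbrs G i).card : ℝ) • z i - ∑ j ∈ nbrs G i, z j
  map_add' x y := by
    ext i
    simp only [PiLp.add_apply, smul_add, Finset.sum_add_distrib]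
    abel
  map_smul' c x := by
    ext i
    simp only [PiLp.smul_apply, RingHom.id_apply, smul_sub, Finset.smul_sum, smul_comm c]

theorem lapOp_apply (G : SimpleGraph (Fin M)) (z : Stack M E) (i : Fin M) :
    lapOp G z i = ∑ j ∈ nbrs G i, (z i - z j) := by
  simp [lapOp, Finset.sum_sub_distrib, Nat.cast_smul_eq_nsmul]

open scoped Classical in
theorem sum_nbrs (G : SimpleGraph (Fin M)) (i : Fin M) {α : Type*} [AddCommMonoid α]
    (h : Fin M → α) : ∑ j ∈ nbrs G i, h j = ∑ j, if G.Adj i j then h j else 0 := by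
  rw [nbrs, Finset.sum_filter]

theorem mem_nbrs (G : SimpleGraph (Fin M)) (i j : Fin M) : j ∈ nbrs G i ↔ G.Adj i j := by
  simp [nbrs]

theorem sum_sum_nbrs_comm (G : SimpleGraph (Fin M)) {α : Type*} [AddCommMonoid α]
    (h : Fin M → Fin M → α) :
    ∑ i, ∑ j ∈ nbrs G i, h i j = ∑ i, ∑ j ∈ nbrs G i, h j i := by
  classical
  simp only [sum_nbrs]
  rw [Finset.sum_comm]
  simp only [G.adj_comm]

/-- Exchanging the two ends of every edge changes the sign of the sum. -/
theorem sum_lapOp (G : SimpleGraph (Fin M)) (z : Stack M E) : ∑ i, lapOp G z i = 0 := by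
  have h : ∑ i, lapOp G z i = -∑ i, lapOp G z i := by
    simp only [lapOp_apply]
    conv_lhs => rw [sum_sum_nbrs_comm]
    simp only [← Finset.sum_neg_distrib, neg_sub]
  have h2 : (2 : ℝ) • ∑ i, lapOp G z i = 0 := by
    rw [two_smul]; nth_rewrite 1 [h]; simp
  exact (smul_eq_zero.mp h2).resolve_left two_ne_zero

theorem inner_lapOp (G : SimpleGraph (Fin M)) (x y : Stack M E) :
    inner ℝ (lapOp G x) y =
      (1 / 2) * ∑ i, ∑ j ∈ nbrs G i, inner ℝ (x i - x j) (y i - y j) := by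
  have h1 : inner ℝ (lapOp G x) y = ∑ i, ∑ j ∈ nbrs G i, inner ℝ (x i - x j) (y i) := by
    rw [PiLp.inner_apply]
    simp only [lapOp_apply, sum_inner]
  have h2 : inner ℝ (lapOp G x) y = ∑ i, ∑ j ∈ nbrs G i, -inner ℝ (x i - x j) (y j) := by
    rw [h1, sum_sum_nbrs_comm]
    simp only [← inner_neg_left, neg_sub]
  have h3 : ∑ i, ∑ j ∈ nbrs G i, inner ℝ (x i - x j) (y i - y j) =
      inner ℝ (lapOp G x) y + inner ℝ (lapOp G x) y := by
    nth_rewrite 1 [h1]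
    rw [h2]
    simp only [← Finset.sum_add_distrib, inner_sub_right, ← sub_eq_add_neg]
  rw [h3]; ring

theorem lapOp_symm (G : SimpleGraph (Fin M)) (x y : Stack M E) :
    inner ℝ (lapOp G x) y = inner ℝ x (lapOp G y) := by
  rw [real_inner_comm (lapOp G y) x, inner_lapOp, inner_lapOp]
  simp only [real_inner_comm]

theorem inner_lapOp_self (G : SimpleGraph (Fin M)) (x : Stack M E) :
    inner ℝ (lapOp G x) x = (1 / 2) * ∑ i, ∑ j ∈ nbrs G i, ‖x i - x j‖ ^ 2 := by
  rw [inner_lapOp]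
  simp only [real_inner_self_eq_norm_sq]

theorem inner_lapOp_self_nonneg (G : SimpleGraph (Fin M)) (x : Stack M E) :
    0 ≤ inner ℝ (lapOp G x) x := by
  rw [inner_lapOp_self]; positivity

/-- More edges mean more squares in the sum. This lets the Lyapunov function survive the loss of
links. -/
theorem inner_lapOp_self_mono {G G' : SimpleGraph (Fin M)} (h : G ≤ G') (x : Stack M E) :
    inner ℝ (lapOp G x) x ≤ inner ℝ (lapOp G' x) x := by
  rw [inner_lapOp_self, inner_lapOp_self]
  gcongr with i
  intro j hj
  rw [mem_nbrs] at hj ⊢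
  exact h hj

/-- A positive semidefinite matrix gives a nonnegative quadratic form on vectors. -/
theorem posSemidef_sum_inner_nonneg {S : Matrix (Fin M) (Fin M) ℝ} (hS : S.PosSemidef)
    (z : Fin M → E) : 0 ≤ ∑ i, ∑ j, S i j * inner ℝ (z i) (z j) := by
  have key : ∑ i, ∑ j, S i j * inner ℝ (z i) (z j) =
      ∑ k, hS.isHermitian.eigenvalues k *
        ‖∑ i, hS.isHermitian.eigenvectorBasis k i • z i‖ ^ 2 := by
    have hS' : ∀ i j, S i j = ∑ k, hS.isHermitian.eigenvalues k *
        (hS.isHermitian.eigenvectorBasis k i * hS.isHermitian.eigenvectorBasis k j) := by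
      intro i j
      conv_lhs => rw [hS.isHermitian.spectral_theorem]
      simp [Unitary.conjStarAlgAut_apply, Matrix.mul_apply, Matrix.diagonal_apply,
        Matrix.star_apply, mul_comm, mul_assoc]
    have hR : ∀ k, hS.isHermitian.eigenvalues k *
        ‖∑ i, hS.isHermitian.eigenvectorBasis k i • z i‖ ^ 2 =
        ∑ i, ∑ j, hS.isHermitian.eigenvalues k * (hS.isHermitian.eigenvectorBasis k i *
          hS.isHermitian.eigenvectorBasis k j) * inner ℝ (z i) (z j) := by
      intro k
      simp only [← real_inner_self_eq_norm_sq, sum_inner, inner_sum, real_inner_smul_left,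
        real_inner_smul_right, Finset.mul_sum]
      rw [Finset.sum_comm]
      refine Finset.sum_congr rfl fun i _ => Finset.sum_congr rfl fun j _ => ?_
      ring
    simp only [hR, hS', Finset.sum_mul]
    symm
    rw [Finset.sum_comm]
    exact Finset.sum_congr rfl fun i _ => Finset.sum_comm
  rw [key]
  exact Finset.sum_nonneg fun k _ => mul_nonneg (hS.eigenvalues_nonneg k) (by positivity)

open scoped Classical in
theorem inner_lapOp_eq_sum_lapMatrix (G : SimpleGraph (Fin M)) (x : Stack M E) :
    inner ℝ (lapOp G x) x = ∑ i, ∑ j, G.lapMatrix ℝ i j * inner ℝ (x i) (x j) := by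
  rw [PiLp.inner_apply]
  refine Finset.sum_congr rfl fun i _ => ?_
  have hdeg : G.degree i = (nbrs G i).card := by
    rw [← SimpleGraph.card_neighborFinset_eq_degree]
    congr 1
    ext j
    simp [mem_nbrs]
  simp only [SimpleGraph.lapMatrix, SimpleGraph.degMatrix, Matrix.sub_apply, sub_mul,
    Finset.sum_sub_distrib, Matrix.diagonal_apply, SimpleGraph.adjMatrix_apply, ite_mul, zero_mul,
    one_mul, Finset.sum_ite_eq, Finset.mem_univ, if_true, hdeg]
  simp only [lapOp, LinearMap.coe_mk, AddHom.coe_mk, inner_sub_left, real_inner_smul_left,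
    sum_inner, ← sum_nbrs]
  congr 1
  exact Finset.sum_congr rfl fun j _ => real_inner_comm _ _

theorem isLapEigenvalue_of_mulVec {G : SimpleGraph (Fin M)} {t : ℝ} {v : Fin M → ℝ} (hv : v ≠ 0)
    [DecidableRel G.Adj] (h : (G.lapMatrix ℝ).mulVec v = t • v) : IsLapEigenvalue G t := by
  refine Module.End.hasEigenvalue_of_hasEigenvector (x := v) ⟨?_, hv⟩
  rw [Module.End.mem_eigenspace_iff, Matrix.toLin'_apply, ← h]
  congr!

theorem posSemidef_of_forall_eigenvector {S : Matrix (Fin M) (Fin M) ℝ} (hS : S.IsHermitian)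
    (h : ∀ (v : Fin M → ℝ) (t : ℝ), v ≠ 0 → S.mulVec v = t • v → 0 ≤ t) : S.PosSemidef := by
  rw [hS.posSemidef_iff_eigenvalues_nonneg]
  intro k
  refine h (hS.eigenvectorBasis k) _ (fun h0 => ?_) (hS.mulVec_eigenvectorBasis k)
  exact hS.eigenvectorBasis.orthonormal.ne_zero k (by ext i; exact congrFun h0 i)

/-- An eigenvector of `Λ • 1 - lapMatrix` for `t` is a Laplacian eigenvector for `Λ - t`, so `t ≥
0`; the scalar semidefiniteness then passes to vector-valued data. -/
theorem inner_lapOp_le {G : SimpleGraph (Fin M)} {Λ : ℝ} (hG : ∀ t, IsLapEigenvalue G t → t ≤ Λ)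
    (x : Stack M E) : inner ℝ (lapOp G x) x ≤ Λ * ‖x‖ ^ 2 := by
  classical
  set S : Matrix (Fin M) (Fin M) ℝ := Λ • 1 - G.lapMatrix ℝ with hSdef
  have hH : S.IsHermitian :=
    (Matrix.isHermitian_one.smul (by simp [IsSelfAdjoint])).sub (G.isHermitian_lapMatrix ℝ)
  have hS : S.PosSemidef := by
    refine posSemidef_of_forall_eigenvector hH fun v t hv h => ?_
    rw [hSdef, Matrix.sub_mulVec, Matrix.smul_mulVec, Matrix.one_mulVec] at h
    have h1 : (G.lapMatrix ℝ).mulVec v = (Λ - t) • v := by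
      rw [sub_smul, ← h]; simp
    have := hG _ (isLapEigenvalue_of_mulVec hv h1)
    linarith
  have h := posSemidef_sum_inner_nonneg hS x
  rw [inner_lapOp_eq_sum_lapMatrix, PiLp.norm_sq_eq_of_L2]
  simp only [hSdef, Matrix.sub_apply, Matrix.smul_apply, Matrix.one_apply, sub_mul,
    Finset.sum_sub_distrib, smul_eq_mul, mul_ite, mul_one, mul_zero, ite_mul, zero_mul,
    Finset.sum_ite_eq, Finset.mem_univ, if_true, real_inner_self_eq_norm_sq,
    ← Finset.mul_sum] at h
  linarith

/-- On families with sum zero the averaging matrix `J` contributes nothing, so it suffices that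
`lapMatrix - l • (1 - J)` is positive semidefinite. An eigenvector for a negative `t` would have sum
zero, hence be a Laplacian eigenvector for `t + l < l`. This forces `t + l = 0`, and connectedness
makes the vector constant, hence zero. -/
theorem le_inner_lapOp {G : SimpleGraph (Fin M)} (hconn : G.Connected) {l : ℝ}
    (hG : ∀ t, 0 < t → IsLapEigenvalue G t → l ≤ t)
    (x : Stack M E) (hx : ∑ i, x i = 0) : l * ‖x‖ ^ 2 ≤ inner ℝ (lapOp G x) x := by
  classical
  have := hconn.nonempty
  have hM : (M : ℝ) ≠ 0 := by
    have : 0 < M := Fin.pos_iff_nonempty.mpr this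
    positivity
  set J : Matrix (Fin M) (Fin M) ℝ := Matrix.of fun _ _ => (M : ℝ)⁻¹ with hJ
  set S : Matrix (Fin M) (Fin M) ℝ := G.lapMatrix ℝ - l • (1 - J) with hSdef
  have hJH : J.IsHermitian := by ext i j; simp [hJ]
  have hH : S.IsHermitian :=
    (G.isHermitian_lapMatrix ℝ).sub
      ((Matrix.isHermitian_one.sub hJH).smul (by simp [IsSelfAdjoint]))
  have hsumL : ∀ v : Fin M → ℝ, ∑ i, (G.lapMatrix ℝ).mulVec v i = 0 := by
    intro v
    have h1 : ∑ i, (G.lapMatrix ℝ).mulVec v i =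
        dotProduct (fun _ => (1 : ℝ)) ((G.lapMatrix ℝ).mulVec v) := by simp [dotProduct]
    rw [h1, Matrix.dotProduct_mulVec, ← Matrix.mulVec_transpose, (G.isSymm_lapMatrix (R := ℝ)).eq,
      SimpleGraph.lapMatrix_mulVec_const_eq_zero]
    simp
  have hJv : ∀ v : Fin M → ℝ, J.mulVec v = fun _ => (M : ℝ)⁻¹ * ∑ j, v j := by
    intro v; ext i; simp [hJ, Matrix.mulVec, dotProduct, Finset.mul_sum]
  have hS : S.PosSemidef := by
    refine posSemidef_of_forall_eigenvector hH fun v t hv0 h => ?_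
    by_contra! ht
    rw [hSdef, Matrix.sub_mulVec, Matrix.smul_mulVec, Matrix.sub_mulVec, Matrix.one_mulVec,
      hJv] at h
    have hsum : t * ∑ i, v i = 0 := by
      have h' := congrArg (fun w : Fin M → ℝ => ∑ i, w i) h
      simp only [Pi.sub_apply, Pi.smul_apply, smul_eq_mul, Finset.sum_sub_distrib, hsumL,
        ← Finset.mul_sum, Finset.sum_const, Finset.card_univ, Fintype.card_fin, nsmul_eq_mul] at h'
      rw [← h', inv_mul_cancel_left₀ hM]; ring
    have hsum0 : ∑ i, v i = 0 := (mul_eq_zero.mp hsum).resolve_left ht.ne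
    have h1 : (G.lapMatrix ℝ).mulVec v = (t + l) • v := by
      ext i
      have := congrFun h i
      simp only [hsum0, mul_zero, Pi.sub_apply, Pi.smul_apply, smul_eq_mul] at this ⊢
      linarith
    have hle : t + l ≤ 0 := by
      by_contra! hpos
      have := hG _ hpos (isLapEigenvalue_of_mulVec hv0 h1)
      linarith
    have hge : 0 ≤ t + l := by
      have h2 := (G.posSemidef_lapMatrix ℝ).dotProduct_mulVec_nonneg v
      rw [h1, dotProduct_smul, star_trivial, smul_eq_mul] at h2
      exact nonneg_of_mul_nonneg_left h2 (by
        have := Matrix.dotProduct_star_self_pos_iff.mpr hv0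
        simpa using this)
    rw [le_antisymm hle hge, zero_smul,
      SimpleGraph.lapMatrix_mulVec_eq_zero_iff_forall_reachable] at h1
    apply hv0
    ext i
    have h3 : ∑ j, v j = (M : ℝ) * v i := by
      rw [Finset.sum_congr rfl fun j _ => h1 j i (hconn.preconnected j i)]; simp
    rw [hsum0] at h3
    exact (mul_eq_zero.mp h3.symm).resolve_left hM
  have h := posSemidef_sum_inner_nonneg hS x
  have hJ0 : ∑ i, ∑ j, (M : ℝ)⁻¹ * inner ℝ (x i) (x j) = 0 := by
    simp only [← Finset.mul_sum, ← inner_sum, hx]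
    simp
  rw [inner_lapOp_eq_sum_lapMatrix, PiLp.norm_sq_eq_of_L2]
  simp only [hSdef, hJ, Matrix.sub_apply, Matrix.smul_apply, Matrix.one_apply, sub_mul, mul_sub,
    Finset.sum_sub_distrib, smul_eq_mul, mul_ite, mul_one, mul_zero, ite_mul, zero_mul,
    Finset.sum_ite_eq, Finset.mem_univ, if_true, real_inner_self_eq_norm_sq, Matrix.of_apply,
    mul_assoc, ← Finset.mul_sum] at h hJ0
  rw [hJ0] at h
  linarith

end Laplacian

/-! ### Means and deviations -/

section Mean

variable {M : ℕ} {E : Type*} [NormedAddCommGroup E] [InnerProductSpace ℝ E]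

theorem mean_sub (x y : Fin M → E) : mean (fun m => x m - y m) = mean x - mean y := by
  simp [mean, Finset.sum_sub_distrib, smul_sub]

theorem mean_smul (c : ℝ) (x : Fin M → E) : mean (fun m => c • x m) = c • mean x := by
  simp only [mean, ← Finset.smul_sum, smul_comm c]

theorem mean_const (hM : 0 < M) (c : E) : mean (fun _ : Fin M => c) = c := by
  have : (M : ℝ) ≠ 0 := by positivity
  simp [mean, ← Nat.cast_smul_eq_nsmul ℝ, this]

/-- The deviations of the vectors from their mean. -/
noncomputable def dev (z : Fin M → E) : Stack M E := WithLp.toLp 2 fun m => z m - mean z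

theorem dev_sub (x y : Fin M → E) : dev (fun m => x m - y m) = dev x - dev y := by
  ext m; simp only [dev, mean_sub, PiLp.sub_apply]; abel

theorem dev_smul (c : ℝ) (x : Fin M → E) : dev (fun m => c • x m) = c • dev x := by
  ext m; simp only [dev, mean_smul, PiLp.smul_apply, smul_sub]

theorem sum_dev (hM : 0 < M) (z : Fin M → E) : ∑ m, dev z m = 0 := by
  have : (M : ℝ) ≠ 0 := by positivity
  simp [dev, mean, Finset.sum_sub_distrib, ← Nat.cast_smul_eq_nsmul ℝ, smul_smul, this]

theorem mean_lapOp (G : SimpleGraph (Fin M)) (z : Stack M E) :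
    mean (fun m => lapOp G z m) = 0 := by
  rw [mean, sum_lapOp, smul_zero]

/-- The Laplacian sees only differences, so the gossip recursion closes on the deviations. -/
theorem dev_lapOp (G : SimpleGraph (Fin M)) (z : Fin M → E) :
    dev (fun m => lapOp G (WithLp.toLp 2 z) m) = lapOp G (dev z) := by
  ext m
  rw [dev, mean_lapOp]
  simp only [dev, sub_zero, lapOp_apply, sub_sub_sub_cancel_right]

end Mean

/-! ### Convergence of the accelerated gossip procedure -/

section Gossip

variable {M : ℕ} {E : Type*} [NormedAddCommGroup E] [InnerProductSpace ℝ E]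

theorem nbrs_inf (A B : SimpleGraph (Fin M)) (i : Fin M) :
    nbrs A i ∩ nbrs B i = nbrs (A ⊓ B) i := by
  ext j; simp [mem_nbrs]

theorem gossipStep_u {G : ℕ → SimpleGraph (Fin M)} {η β : ℝ} {s : GossipState M E}
    {A : SimpleGraph (Fin M)} (hA : s.links = nbrs A) :
    (gossipStep G η β s).u =
      fun m => s.z m - η • lapOp (A ⊓ G s.round) (WithLp.toLp 2 s.z) m := by
  funext m
  simp [gossipStep, hA, nbrs_inf, lapOp]

theorem gossipStep_z (G : ℕ → SimpleGraph (Fin M)) (η β : ℝ) (s : GossipState M E) :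
    (gossipStep G η β s).z =
      fun m => (1 + β) • (gossipStep G η β s).u m - β • s.u m := rfl

theorem gossipStep_links {G : ℕ → SimpleGraph (Fin M)} {η β : ℝ} {s : GossipState M E}
    {A : SimpleGraph (Fin M)} (hA : s.links = nbrs A) :
    (gossipStep G η β s).links = nbrs (A ⊓ G s.round) := by
  funext m
  simp [gossipStep, hA, nbrs_inf]

theorem accGossip_succ (G : ℕ → SimpleGraph (Fin M)) (η β : ℝ) (H k₀ : ℕ) (z : Fin M → E) :
    accGossip G η β (H + 1) k₀ z = gossipStep G η β (accGossip G η β H k₀ z) := by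
  rw [accGossip, Function.iterate_succ_apply', accGossip]

theorem accGossip_round (G : ℕ → SimpleGraph (Fin M)) (η β : ℝ) (H k₀ : ℕ) (z : Fin M → E) :
    (accGossip G η β H k₀ z).round = k₀ + H := by
  induction H with
  | zero => rfl
  | succ H ih => rw [accGossip_succ, ← add_assoc, ← ih]; rfl

/-- The links in use always come from an undirected graph squeezed between the skeleton and the
first graph of the phase; both curvature bounds follow from this. -/
theorem accGossip_links (G : ℕ → SimpleGraph (Fin M)) (η β : ℝ) (H k₀ : ℕ) (z : Fin M → E)
    {Ghat : SimpleGraph (Fin M)} (hG : ∀ k, Ghat ≤ G k) :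
    ∃ A, (accGossip G η β H k₀ z).links = nbrs A ∧ Ghat ≤ A ∧ A ≤ G k₀ := by
  induction H with
  | zero => exact ⟨G k₀, rfl, hG k₀, le_rfl⟩
  | succ H ih =>
    obtain ⟨A, hA, h1, h2⟩ := ih
    rw [accGossip_succ]
    exact ⟨_, gossipStep_links hA, le_inf h1 (hG _), inf_le_left.trans h2⟩

theorem mean_accGossip (G : ℕ → SimpleGraph (Fin M)) (η β : ℝ) (H k₀ : ℕ) (z : Fin M → E) :
    mean (accGossip G η β H k₀ z).u = mean z ∧ mean (accGossip G η β H k₀ z).z = mean z := by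
  induction H with
  | zero => exact ⟨rfl, rfl⟩
  | succ H ih =>
    -- Preservation of the mean needs only that the links form some graph, so the empty skeleton is
    -- enough.
    obtain ⟨A, hA, -, -⟩ := accGossip_links (Ghat := ⊥) G η β H k₀ z (fun _ => bot_le)
    rw [accGossip_succ]
    have hu : mean (gossipStep G η β (accGossip G η β H k₀ z)).u = mean z := by
      rw [gossipStep_u hA, mean_sub, mean_smul, mean_lapOp, ih.2]; simp
    refine ⟨hu, ?_⟩
    rw [gossipStep_z, mean_sub, mean_smul, mean_smul, hu, ih.1]
    module

/-- The Lyapunov function of accelerated gossip. -/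
noncomputable def gossipPotential (A : SimpleGraph (Fin M)) (l q : ℝ) (u z : Fin M → E) : ℝ :=
  (1 / 2) * inner ℝ (lapOp A (dev u)) (dev u) +
    l / 2 * ‖q⁻¹ • ((1 + q) • dev z - dev u)‖ ^ 2

/-- Nesterov's step on the new graph `B = A ⊓ G s.round`, with `dev u` as `x`, `dev z` as `y` and
the vector inside the norm of the potential as `v`. The right-hand side first appears with `B`;
monotonicity of the form replaces `B` by the larger graph `A`. -/
theorem gossipPotential_step {G : ℕ → SimpleGraph (Fin M)} {s : GossipState M E}
    {A Ghat : SimpleGraph (Fin M)} (hA : s.links = nbrs A) (hM : 0 < M)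
    {Λ l q : ℝ} (hΛ : 0 < Λ) (hq : 0 < q) (hq1 : q ≤ 1) (hqΛ : q ^ 2 * Λ = l)
    (hupper : ∀ x : Stack M E, inner ℝ (lapOp A x) x ≤ Λ * ‖x‖ ^ 2)
    (hlower : ∀ x : Stack M E, ∑ i, x i = 0 → l * ‖x‖ ^ 2 ≤ inner ℝ (lapOp Ghat x) x)
    (hGhat : Ghat ≤ A) (hG : Ghat ≤ G s.round) :
    gossipPotential (A ⊓ G s.round) l q
        (gossipStep G (1 / Λ) ((1 - q) / (1 + q)) s).u
        (gossipStep G (1 / Λ) ((1 - q) / (1 + q)) s).z ≤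
      (1 - q) * gossipPotential A l q s.u s.z := by
  set B := A ⊓ G s.round
  have hdu : dev (gossipStep G (1 / Λ) ((1 - q) / (1 + q)) s).u =
      dev s.z - Λ⁻¹ • lapOp B (dev s.z) := by
    rw [gossipStep_u hA, dev_sub, dev_smul, dev_lapOp, one_div]
  have hdz : dev (gossipStep G (1 / Λ) ((1 - q) / (1 + q)) s).z =
      (1 + (1 - q) / (1 + q)) • (dev s.z - Λ⁻¹ • lapOp B (dev s.z)) -
        ((1 - q) / (1 + q)) • dev s.u := by
    rw [gossipStep_z, dev_sub, dev_smul, dev_smul, hdu]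
  have hq0 : q ≠ 0 := hq.ne'
  have hq2 : 1 + q ≠ 0 := by positivity
  have key := nesterov_step (lapOp B) (lapOp_symm B) (inner_lapOp_self_nonneg B) hΛ hq hq1 hqΛ
    (fun x => (inner_lapOp_self_mono inf_le_left x).trans (hupper x))
    (x := dev s.u) (y := dev s.z) (v := q⁻¹ • ((1 + q) • dev s.z - dev s.u))
    ((hlower _ (sum_dev hM _)).trans (inner_lapOp_self_mono (le_inf hGhat hG) _))
    (by rw [smul_inv_smul₀ hq0]; abel)
  -- The momentum `(1 - q) / (1 + q)` is the one for which this combination of the new `u` and `z`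
  -- is Nesterov's update of `v`.
  have hv : q⁻¹ • ((1 + q) • dev (gossipStep G (1 / Λ) ((1 - q) / (1 + q)) s).z -
        dev (gossipStep G (1 / Λ) ((1 - q) / (1 + q)) s).u) =
      (1 - q) • q⁻¹ • ((1 + q) • dev s.z - dev s.u) + q • dev s.z -
        (q / l) • lapOp B (dev s.z) := by
    rw [hdz, hdu, ← hqΛ]
    match_scalars <;> field_simp <;> ring
  rw [gossipPotential, hv, hdu]
  refine key.trans (mul_le_mul_of_nonneg_left ?_ (by linarith))
  rw [gossipPotential]
  gcongr
  exact inner_lapOp_self_mono inf_le_left _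

theorem norm_dev_sq_le_gossipPotential {A : SimpleGraph (Fin M)} {l q : ℝ} (hl : 0 < l)
    (hq : 0 < q) (hq1 : q ≤ 1) {u z : Fin M → E}
    (hlower : l * ‖dev u‖ ^ 2 ≤ inner ℝ (lapOp A (dev u)) (dev u)) :
    l / 2 * ‖dev z‖ ^ 2 ≤ gossipPotential A l q u z := by
  rw [gossipPotential]
  set v := q⁻¹ • ((1 + q) • dev z - dev u) with hv
  have hz : (1 + q) • dev z = dev u + q • v := by
    rw [hv, smul_inv_smul₀ hq.ne']; abel
  have h1 : (1 + q) * ‖dev z‖ ≤ ‖dev u‖ + q * ‖v‖ := by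
    calc (1 + q) * ‖dev z‖ = ‖(1 + q) • dev z‖ := by
          rw [norm_smul, Real.norm_of_nonneg (by positivity)]
      _ ≤ ‖dev u‖ + ‖q • v‖ := by rw [hz]; exact norm_add_le _ _
      _ = _ := by rw [norm_smul, Real.norm_of_nonneg hq.le]
  have h2 : ((1 + q) * ‖dev z‖) ^ 2 ≤ (‖dev u‖ + q * ‖v‖) ^ 2 := by gcongr
  have h3 : (‖dev u‖ + q * ‖v‖) ^ 2 ≤ (1 + q) * (‖dev u‖ ^ 2 + q * ‖v‖ ^ 2) := by
    -- The difference of the two sides is exactly `q * (‖dev u‖ - ‖v‖) ^ 2`.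
    nlinarith [mul_nonneg hq.le (sq_nonneg (‖dev u‖ - ‖v‖))]
  have h4 : (1 + q) * ‖dev z‖ ^ 2 ≤ ‖dev u‖ ^ 2 + q * ‖v‖ ^ 2 := by
    have : (1 + q) * ((1 + q) * ‖dev z‖ ^ 2) ≤ (1 + q) * (‖dev u‖ ^ 2 + q * ‖v‖ ^ 2) := by
      nlinarith
    exact le_of_mul_le_mul_left this (by positivity)
  have h5 : ‖dev z‖ ^ 2 ≤ ‖dev u‖ ^ 2 + ‖v‖ ^ 2 := by
    nlinarith [sq_nonneg ‖v‖, sq_nonneg ‖dev z‖]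
  nlinarith

/-- Accelerated gossip contracts the deviations from the mean. -/
theorem norm_dev_accGossip_sq_le {G : ℕ → SimpleGraph (Fin M)} {lmin lmax : ℝ}
    (hG : HasConnectedSkeleton G lmin lmax) (hl : lmin ≤ lmax) (H k₀ : ℕ) (z : Fin M → E) :
    ‖dev (accGossip G (1 / lmax)
      ((√(lmax / lmin) - 1) / (√(lmax / lmin) + 1)) H k₀ z).z‖ ^ 2 ≤
      (lmax / lmin + 1) * (1 - (√(lmax / lmin))⁻¹) ^ H * ‖dev z‖ ^ 2 := by
  obtain ⟨hmin, Ghat, hconn, hle, hmax, hmin'⟩ := hG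
  have hmax0 : 0 < lmax := hmin.trans_le hl
  have hM : 0 < M := Fin.pos_iff_nonempty.mpr hconn.nonempty
  set q := (√(lmax / lmin))⁻¹ with hqdef
  have hχ : 0 < √(lmax / lmin) := by positivity
  have hχ1 : 1 ≤ √(lmax / lmin) := by
    rw [Real.one_le_sqrt, one_le_div hmin]; exact hl
  have hq : 0 < q := by positivity
  have hq1 : q ≤ 1 := inv_le_one_of_one_le₀ hχ1
  have hqΛ : q ^ 2 * lmax = lmin := by
    rw [hqdef, inv_pow, Real.sq_sqrt (by positivity)]; field_simp
  have hβ : (√(lmax / lmin) - 1) / (√(lmax / lmin) + 1) = (1 - q) / (1 + q) := by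
    rw [hqdef]; field_simp
  rw [hβ]
  have hupper : ∀ A : SimpleGraph (Fin M), A ≤ G k₀ → ∀ x : Stack M E,
      inner ℝ (lapOp A x) x ≤ lmax * ‖x‖ ^ 2 := fun A hA x =>
    (inner_lapOp_self_mono hA x).trans (inner_lapOp_le (hmax k₀) x)
  have hpot : ∀ H, ∃ A, (accGossip G (1 / lmax) ((1 - q) / (1 + q)) H k₀ z).links = nbrs A ∧
      Ghat ≤ A ∧ A ≤ G k₀ ∧
      gossipPotential A lmin q (accGossip G (1 / lmax) ((1 - q) / (1 + q)) H k₀ z).u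
        (accGossip G (1 / lmax) ((1 - q) / (1 + q)) H k₀ z).z ≤
        (1 - q) ^ H * ((lmax + lmin) / 2 * ‖dev z‖ ^ 2) := by
    intro H
    induction H with
    | zero =>
      refine ⟨G k₀, rfl, hle k₀, le_rfl, ?_⟩
      have h0 : q⁻¹ • ((1 + q) • dev z - dev z) = dev z := by
        rw [add_smul, one_smul, add_sub_cancel_left, inv_smul_smul₀ hq.ne']
      simp only [accGossip, Function.iterate_zero, id, gossipInit, gossipPotential, h0, pow_zero]
      linarith [hupper _ le_rfl (dev z)]
    | succ H ih =>
      obtain ⟨A, hA, h1, h2, h3⟩ := ih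
      rw [accGossip_succ]
      refine ⟨_, gossipStep_links hA, le_inf h1 (hle _), inf_le_left.trans h2, ?_⟩
      refine (gossipPotential_step hA hM hmax0 hq hq1 hqΛ (hupper A h2)
        (le_inner_lapOp hconn hmin') h1 (hle _)).trans ?_
      rw [pow_succ', mul_assoc]
      exact mul_le_mul_of_nonneg_left h3 (by linarith)
  obtain ⟨A, -, hA, -, h⟩ := hpot H
  have h' := (norm_dev_sq_le_gossipPotential hmin hq hq1
    ((le_inner_lapOp hconn hmin' _ (sum_dev hM _)).trans (inner_lapOp_self_mono hA _))).trans h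
  -- The factor `lmax / lmin + 1` is the initial bound `(lmax + lmin) / 2` divided by the constant
  -- `lmin / 2` with which the potential controls `‖dev z‖ ^ 2`.
  have e : lmin / 2 * ((lmax / lmin + 1) * (1 - q) ^ H * ‖dev z‖ ^ 2) =
      (1 - q) ^ H * ((lmax + lmin) / 2 * ‖dev z‖ ^ 2) := by
    field_simp
  rw [← e] at h'
  exact le_of_mul_le_mul_left h' (by positivity)

/-- A nonzero family with sum zero, here a difference of two basis vectors, is compared in both
spectral bounds. A single node has no positive Laplacian eigenvalue, so `lmin` may then exceed
`lmax`. -/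
theorem HasConnectedSkeleton.lmin_le_lmax {G : ℕ → SimpleGraph (Fin M)} {lmin lmax : ℝ}
    (hG : HasConnectedSkeleton G lmin lmax) (hM : 1 < M) : lmin ≤ lmax := by
  obtain ⟨hmin, Ghat, hconn, hle, hmax, hmin'⟩ := hG
  have : Nontrivial (Fin M) := Fin.nontrivial_iff_two_le.mpr hM
  obtain ⟨i, j, hij⟩ := exists_pair_ne (Fin M)
  set x : Stack M ℝ := WithLp.toLp 2 (Pi.single i 1 - Pi.single j 1) with hx
  have hsum : ∑ k, x k = 0 := by simp [hx]
  have hx0 : 0 < ‖x‖ ^ 2 := by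
    have : x ≠ 0 := by
      intro h
      have := congrArg (fun y : Stack M ℝ => y i) h
      simp [hx, hij] at this
    positivity
  exact le_of_mul_le_mul_right ((le_inner_lapOp hconn hmin' x hsum).trans
    ((inner_lapOp_self_mono (hle 0) x).trans (inner_lapOp_le (hmax 0) x))) hx0

end Gossip

/-! ### Root mean squares -/

section Rms

variable {M : ℕ} {E : Type*} [NormedAddCommGroup E]

/-- Root mean square of the norms of the vectors held by the nodes. -/
noncomputable def rms (z : Fin M → E) : ℝ := (√M)⁻¹ * ‖(WithLp.toLp 2 z : Stack M E)‖

theorem rms_nonneg (z : Fin M → E) : 0 ≤ rms z := by unfold rms; positivity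

theorem rms_sq (z : Fin M → E) : rms z ^ 2 = (M : ℝ)⁻¹ * ∑ m, ‖z m‖ ^ 2 := by
  rw [rms, mul_pow, inv_pow, Real.sq_sqrt (Nat.cast_nonneg M), PiLp.norm_sq_eq_of_L2]

theorem rms_add_le (x y : Fin M → E) : rms (fun m => x m + y m) ≤ rms x + rms y := by
  unfold rms
  rw [← mul_add]
  exact mul_le_mul_of_nonneg_left
    (norm_add_le (WithLp.toLp 2 x : Stack M E) (WithLp.toLp 2 y)) (by positivity)

theorem rms_const (hM : 0 < M) (c : E) : rms (fun _ : Fin M => c) = ‖c‖ := by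
  rw [← sq_eq_sq₀ (rms_nonneg _) (norm_nonneg c), rms_sq]
  have : (M : ℝ) ≠ 0 := by positivity
  simp [this]

theorem rms_le_mul {x y : Fin M → E} {c : ℝ} (hc : 0 ≤ c) (h : ∀ m, ‖x m‖ ≤ c * ‖y m‖) :
    rms x ≤ c * rms y := by
  have hm : ∀ m, ‖x m‖ ^ 2 ≤ c ^ 2 * ‖y m‖ ^ 2 := fun m => by
    rw [← mul_pow]; exact pow_le_pow_left₀ (norm_nonneg _) (h m) 2
  rw [← sq_le_sq₀ (rms_nonneg _) (mul_nonneg hc (rms_nonneg _)), mul_pow, rms_sq, rms_sq]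
  calc (M : ℝ)⁻¹ * ∑ m, ‖x m‖ ^ 2 ≤ (M : ℝ)⁻¹ * ∑ m, c ^ 2 * ‖y m‖ ^ 2 := by
        gcongr with m; exact hm m
    _ = _ := by rw [← Finset.mul_sum]; ring

variable [InnerProductSpace ℝ E]

theorem norm_mean_le_rms (hM : 0 < M) (z : Fin M → E) : ‖mean z‖ ≤ rms z := by
  have hM' : (0 : ℝ) < M := by positivity
  rw [← sq_le_sq₀ (norm_nonneg _) (rms_nonneg _), rms_sq, mean, norm_smul, mul_pow,
    Real.norm_of_nonneg (by positivity)]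
  have h1 : ‖∑ m, z m‖ ^ 2 ≤ M * ∑ m, ‖z m‖ ^ 2 := by
    calc ‖∑ m, z m‖ ^ 2 ≤ (∑ m, ‖z m‖) ^ 2 := by gcongr; exact norm_sum_le _ _
      _ ≤ _ := by simpa using sq_sum_le_card_mul_sum_sq (s := Finset.univ) (f := fun m => ‖z m‖)
  calc ((M : ℝ)⁻¹) ^ 2 * ‖∑ m, z m‖ ^ 2 ≤ ((M : ℝ)⁻¹) ^ 2 * (M * ∑ m, ‖z m‖ ^ 2) := by gcongr
    _ = _ := by field_simp

/-- Root mean square deviation from the mean. -/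
noncomputable def spread (z : Fin M → E) : ℝ := rms fun m => z m - mean z

theorem spread_nonneg (z : Fin M → E) : 0 ≤ spread z := rms_nonneg _

theorem spread_eq (z : Fin M → E) : spread z = (√M)⁻¹ * ‖dev z‖ := rfl

/-- The mean minimizes the mean squared distance: the cross term vanishes because deviations sum to
zero. -/
theorem spread_le_rms_sub (hM : 0 < M) (z : Fin M → E) (c : E) :
    spread z ≤ rms fun m => z m - c := by
  have hM' : (M : ℝ) ≠ 0 := by positivity
  rw [spread, ← sq_le_sq₀ (rms_nonneg _) (rms_nonneg _), rms_sq, rms_sq]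
  have h1 : ∑ m, inner ℝ (z m - mean z) (mean z - c) = 0 := by
    have := sum_dev hM z
    simp only [dev] at this
    rw [← sum_inner, this, inner_zero_left]
  have h2 : ∑ m, ‖z m - c‖ ^ 2 = ∑ m, ‖z m - mean z‖ ^ 2 + M * ‖mean z - c‖ ^ 2 := by
    have : ∀ m, ‖z m - c‖ ^ 2 = ‖z m - mean z‖ ^ 2 + 2 * inner ℝ (z m - mean z) (mean z - c) +
        ‖mean z - c‖ ^ 2 := by
      intro m
      rw [← norm_add_sq_real, sub_add_sub_cancel]
    simp only [this, Finset.sum_add_distrib, ← Finset.mul_sum, h1]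
    simp
  rw [h2]
  gcongr
  have : 0 ≤ (M : ℝ) * ‖mean z - c‖ ^ 2 := by positivity
  linarith

theorem spread_le_rms (hM : 0 < M) (z : Fin M → E) : spread z ≤ rms z := by
  simpa using spread_le_rms_sub hM z 0

theorem spread_sub_smul_le (x y : Fin M → E) {c : ℝ} (hc : 0 ≤ c) :
    spread (fun m => x m - c • y m) ≤ spread x + c * spread y := by
  simp only [spread_eq, dev_sub, dev_smul]
  have : ‖dev x - c • dev y‖ ≤ ‖dev x‖ + c * ‖dev y‖ := by
    refine (norm_sub_le _ _).trans_eq ?_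
    rw [norm_smul, Real.norm_of_nonneg hc]
  calc (√(M : ℝ))⁻¹ * ‖dev x - c • dev y‖ ≤ (√(M : ℝ))⁻¹ * (‖dev x‖ + c * ‖dev y‖) := by gcongr
    _ = _ := by ring

theorem rms_sub_le_spread_add (hM : 0 < M) (z : Fin M → E) (c : E) :
    rms (fun m => z m - c) ≤ spread z + ‖mean z - c‖ := by
  rw [← rms_const hM (mean z - c)]
  refine le_trans (le_of_eq ?_) (rms_add_le _ _)
  simp only [sub_add_sub_cancel]

theorem norm_mean_sub_le_rms (hM : 0 < M) (z : Fin M → E) (c : E) :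
    ‖mean z - c‖ ≤ rms fun m => z m - c := by
  have := norm_mean_le_rms hM fun m => z m - c
  rwa [mean_sub, mean_const hM] at this

end Rms

/-! ### Projections -/

section Projection

variable {E : Type*} [NormedAddCommGroup E] [InnerProductSpace ℝ E] {Z : Set E}

theorem IsProj.inner_nonneg (hconv : Convex ℝ Z) {z w : E} (h : IsProj Z z w) {v : E}
    (hv : v ∈ Z) : 0 ≤ inner ℝ (z - w) (w - v) := by
  have : Nonempty Z := ⟨⟨v, hv⟩⟩
  have h1 : ‖z - w‖ = ⨅ x : Z, ‖z - x‖ := by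
    apply le_antisymm
    · exact le_ciInf fun x => h.2 x x.2
    · exact ciInf_le (f := fun x : Z => ‖z - x‖)
        ⟨0, by rintro _ ⟨x, rfl⟩; exact norm_nonneg _⟩ ⟨w, h.1⟩
  have h2 := (norm_eq_iInf_iff_real_inner_le_zero hconv h.1).mp h1 v hv
  rw [← neg_sub v w, inner_neg_right]
  linarith

/-- Points with the variational characterization of the projection are at distance at most that of
the points projected. -/
theorem norm_sub_le_of_inner_nonneg {z z' w w' : E} (h : 0 ≤ inner ℝ (z - w) (w - w'))
    (h' : 0 ≤ inner ℝ (z' - w') (w' - w)) : ‖w - w'‖ ≤ ‖z - z'‖ := by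
  have h1 : ‖w - w'‖ ^ 2 ≤ inner ℝ (z - z') (w - w') := by
    rw [← neg_sub w w', inner_neg_right] at h'
    have : inner ℝ (z - z') (w - w') =
        inner ℝ (z - w) (w - w') - inner ℝ (z' - w') (w - w') + inner ℝ (w - w') (w - w') := by
      rw [← inner_sub_left, ← inner_add_left]; congr 1; abel
    rw [real_inner_self_eq_norm_sq] at this
    linarith
  have h2 := real_inner_le_norm (z - z') (w - w')
  by_contra! h3
  nlinarith [norm_nonneg (z - z')]

/-- One exact extragradient step contracts the distance to the solution. -/
theorem extragradient_contraction {F : E → E} {L μ γ : ℝ} {x h t zs : E} (hγ : 0 < γ)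
    (hμ : 0 < μ) (hL : γ * L ≤ 1 / 4) (hμ4 : γ * μ ≤ 1 / 4)
    (hlip : ‖F x - F h‖ ≤ L * ‖x - h‖)
    (hstrong : μ * ‖h - zs‖ ^ 2 ≤ inner ℝ (F h - F zs) (h - zs))
    (hvi : 0 ≤ inner ℝ (F zs) (h - zs))
    (hh : 0 ≤ inner ℝ (x - γ • F x - h) (h - t))
    (ht : 0 ≤ inner ℝ (x - γ • F h - t) (t - zs)) :
    ‖t - zs‖ ≤ (1 - γ * μ / 2) * ‖x - zs‖ := by
  have e1 : ‖x - zs‖ ^ 2 = ‖x - t‖ ^ 2 + 2 * inner ℝ (x - t) (t - zs) + ‖t - zs‖ ^ 2 := by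
    rw [← norm_add_sq_real, sub_add_sub_cancel]
  have e2 : ‖x - t‖ ^ 2 = ‖x - h‖ ^ 2 + 2 * inner ℝ (x - h) (h - t) + ‖h - t‖ ^ 2 := by
    rw [← norm_add_sq_real, sub_add_sub_cancel]
  have e3 : inner ℝ (x - γ • F h - t) (t - zs) =
      inner ℝ (x - t) (t - zs) - γ * inner ℝ (F h) (t - zs) := by
    rw [← real_inner_smul_left, ← inner_sub_left]; congr 1; abel
  have e4 : inner ℝ (x - γ • F x - h) (h - t) =
      inner ℝ (x - h) (h - t) - γ * inner ℝ (F x) (h - t) := by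
    rw [← real_inner_smul_left, ← inner_sub_left]; congr 1; abel
  have e5 : inner ℝ (F h) (t - zs) = inner ℝ (F h) (h - zs) - inner ℝ (F h) (h - t) := by
    rw [← inner_sub_right]; congr 1; abel
  have e6 : inner ℝ (F x - F h) (h - t) = inner ℝ (F x) (h - t) - inner ℝ (F h) (h - t) :=
    inner_sub_left _ _ _
  have e7 : inner ℝ (F h - F zs) (h - zs) = inner ℝ (F h) (h - zs) - inner ℝ (F zs) (h - zs) :=
    inner_sub_left _ _ _
  -- Young's inequality with `γ L ≤ 1/4`. The term `‖h - t‖ ^ 2` is cancelled by `e2`, leaving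
  -- `15/16` of `‖x - h‖ ^ 2`.
  have h1 : -(2 * γ * inner ℝ (F x - F h) (h - t)) ≤ 1 / 16 * ‖x - h‖ ^ 2 + ‖h - t‖ ^ 2 := by
    have h2 := abs_le.mp (abs_real_inner_le_norm (F x - F h) (h - t))
    have h3 : γ * ‖F x - F h‖ ≤ 1 / 4 * ‖x - h‖ := by
      calc γ * ‖F x - F h‖ ≤ γ * (L * ‖x - h‖) := by gcongr
        _ = (γ * L) * ‖x - h‖ := by ring
        _ ≤ _ := by gcongr
    have h4 : γ * (‖F x - F h‖ * ‖h - t‖) ≤ 1 / 4 * ‖x - h‖ * ‖h - t‖ := by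
      rw [← mul_assoc]; gcongr
    have h5 := mul_le_mul_of_nonneg_left h2.1 hγ.le
    nlinarith [sq_nonneg (1 / 4 * ‖x - h‖ - ‖h - t‖)]
  have h6 : ‖x - zs‖ ^ 2 ≤ 2 * ‖x - h‖ ^ 2 + 2 * ‖h - zs‖ ^ 2 := by
    have : ‖x - zs‖ ≤ ‖x - h‖ + ‖h - zs‖ := by
      rw [← sub_add_sub_cancel x h zs]; exact norm_add_le _ _
    nlinarith [sq_nonneg (‖x - h‖ - ‖h - zs‖), norm_nonneg (x - zs)]
  have h7 : γ * (μ * ‖h - zs‖ ^ 2) ≤ γ * inner ℝ (F h) (h - zs) := by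
    gcongr; linarith
  have h8 : ‖t - zs‖ ^ 2 ≤ ‖x - zs‖ ^ 2 - 15 / 16 * ‖x - h‖ ^ 2 - 2 * (γ * μ) * ‖h - zs‖ ^ 2 := by
    nlinarith
  -- The distance from `h` is traded for the distance from `x` by `h6`, at a cost of `2 γμ ‖x - h‖ ^
  -- 2`, which the `15/16` pays since `γμ ≤ 1/4`.
  have h9 : ‖t - zs‖ ^ 2 ≤ (1 - γ * μ) * ‖x - zs‖ ^ 2 := by
    have h10 := mul_le_mul_of_nonneg_left h6 (mul_pos hγ hμ).le
    have h11 := mul_le_mul_of_nonneg_right hμ4 (sq_nonneg ‖x - h‖)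
    nlinarith [sq_nonneg ‖x - h‖]
  refine (sq_le_sq₀ (norm_nonneg _) (mul_nonneg (by linarith) (norm_nonneg _))).mp ?_
  rw [mul_pow]
  refine h9.trans ?_
  gcongr
  nlinarith [sq_nonneg (γ * μ)]

end Projection

/-! ### One iteration of the decentralized method -/

section Step

variable {M : ℕ} {E : Type*} [NormedAddCommGroup E] [InnerProductSpace ℝ E]

theorem mean_mem {Z : Set E} (hconv : Convex ℝ Z) (hM : 0 < M) {z : Fin M → E}
    (hz : ∀ m, z m ∈ Z) : mean z ∈ Z := by
  have hM' : (M : ℝ) ≠ 0 := by positivity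
  rw [mean, Finset.smul_sum]
  exact hconv.sum_mem (fun _ _ => by positivity) (by simp [hM']) fun m _ => hz m

theorem rms_proj_sub_le {Z : Set E} (hconv : Convex ℝ Z) {a w : Fin M → E} {ā p : E}
    (hw : ∀ m, IsProj Z (a m) (w m)) (hp : IsProj Z ā p) :
    rms (fun m => w m - p) ≤ rms fun m => a m - ā := by
  have := rms_le_mul (x := fun m => w m - p) (y := fun m => a m - ā) zero_le_one fun m => by
    rw [one_mul]
    exact norm_sub_le_of_inner_nonneg ((hw m).inner_nonneg hconv hp.1)
      (hp.inner_nonneg hconv (hw m).1)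
  rwa [one_mul] at this

/-- Bounds on the distance `r` to the solution and the spread `d` after one iteration in which
gossip multiplies spreads by at most `ρ`. -/
theorem decentralized_step {Z : Set E} (hconv : Convex ℝ Z) (hM : 0 < M)
    (hproj : ∀ x, ∃ w, IsProj Z x w)
    {F : Fin M → E → E} {Fb : E → E} (hFb : ∀ x, Fb x = mean fun m => F m x)
    {L ℓ μ γ ρ : ℝ} {zs : E} (hγ : 0 < γ) (hμ : 0 < μ) (hℓ : 0 < ℓ) (hρ : 0 ≤ ρ) (hρ1 : ρ ≤ 1)
    (hL : γ * L ≤ 1 / 4) (hμ4 : γ * μ ≤ 1 / 4)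
    (hlip : ∀ x ∈ Z, ∀ y ∈ Z, ‖Fb x - Fb y‖ ≤ L * ‖x - y‖)
    (hlip' : ∀ m, ∀ x ∈ Z, ∀ y ∈ Z, ‖F m x - F m y‖ ≤ ℓ * ‖x - y‖)
    (hstrong : ∀ x ∈ Z, ∀ y ∈ Z, μ * ‖x - y‖ ^ 2 ≤ inner ℝ (Fb x - Fb y) (x - y))
    (hzs : zs ∈ Z) (hvi : ∀ x ∈ Z, 0 ≤ inner ℝ (Fb zs) (x - zs))
    {z a h b z' : Fin M → E} (hz : ∀ m, z m ∈ Z)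
    (ha : mean a = mean fun m => z m - γ • F m (z m))
    (ha' : spread a ≤ ρ * spread fun m => z m - γ • F m (z m))
    (hh : ∀ m, IsProj Z (a m) (h m))
    (hb : mean b = mean fun m => z m - γ • F m (h m))
    (hb' : spread b ≤ ρ * spread fun m => z m - γ • F m (h m))
    (hz' : ∀ m, IsProj Z (b m) (z' m)) {q s : ℝ} (hq : ℓ * q = rms fun m => F m zs)
    (hs : s = γ * ℓ) :
    spread z' ≤ ρ * (2 * (1 + s) ^ 2 * spread z + 2 * s * (1 + s) * (q + ‖mean z - zs‖)) ∧
    ‖mean z' - zs‖ ≤ (1 - γ * μ / 2) * ‖mean z - zs‖ + s * spread z / 4 +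
      ρ * (3 * (1 + s) ^ 2 * spread z + 3 * s * (1 + s) * (q + ‖mean z - zs‖)) := by
  have hs0 : 0 < s := by rw [hs]; positivity
  have hq0 : 0 ≤ q := nonneg_of_mul_nonneg_right (hq ▸ rms_nonneg _) hℓ
  have hxZ : mean z ∈ Z := mean_mem hconv hM hz
  set x := mean z with hx
  set d := spread z with hd
  have hd0 : 0 ≤ d := spread_nonneg z
  set r := ‖x - zs‖ with hr
  have hr0 : 0 ≤ r := norm_nonneg _
  -- local operators at nearby points
  have hFrms : ∀ (y : Fin M → E) (c : E), (∀ m, y m ∈ Z) → c ∈ Z →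
      rms (fun m => F m (y m) - F m c) ≤ ℓ * rms fun m => y m - c := fun y c hy hc =>
    rms_le_mul hℓ.le fun m => hlip' m _ (hy m) _ hc
  have hFmean : ∀ (y : Fin M → E) (c : E), (∀ m, y m ∈ Z) → c ∈ Z →
      ‖(mean fun m => F m (y m)) - Fb c‖ ≤ ℓ * rms fun m => y m - c := by
    intro y c hy hc
    rw [hFb, ← mean_sub]
    exact (norm_mean_le_rms hM _).trans (hFrms y c hy hc)
  have hFspread : ∀ y : Fin M → E, (∀ m, y m ∈ Z) →
      spread (fun m => F m (y m)) ≤ ℓ * q + ℓ * rms fun m => y m - zs := by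
    intro y hy
    refine (spread_le_rms hM _).trans ?_
    have h1 := rms_add_le (fun m => F m zs) (fun m => F m (y m) - F m zs)
    simp only [add_sub_cancel] at h1
    rw [hq]
    linarith [hFrms y zs hy hzs]
  -- first half step
  set Da := spread fun m => z m - γ • F m (z m) with hDa
  have hDa0 : 0 ≤ Da := spread_nonneg _
  have hDa1 : Da ≤ (1 + s) * d + s * (q + r) := by
    have h1 := spread_sub_smul_le z (fun m => F m (z m)) hγ.le
    have h2 := hFspread z hz
    have h3 := rms_sub_le_spread_add hM z zs
    have h4 : γ * spread (fun m => F m (z m)) ≤ γ * (ℓ * q + ℓ * (d + r)) := by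
      gcongr; exact h2.trans (by gcongr)
    calc Da ≤ d + γ * (ℓ * q + ℓ * (d + r)) := h1.trans (by gcongr)
      _ = _ := by rw [hs]; ring
  -- `hb0` is the half point that every node would hold after perfect averaging; the actual `h m`
  -- are `ρ`-close to it.
  obtain ⟨hb0, hhb⟩ := hproj (mean a)
  have hhm : ∀ m, h m ∈ Z := fun m => (hh m).1
  have hh1 : rms (fun m => h m - hb0) ≤ ρ * Da := (rms_proj_sub_le hconv hh hhb).trans ha'
  have hāeq : mean a = x - γ • mean fun m => F m (z m) := by
    rw [ha, mean_sub, mean_smul]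
  set e1 := (mean fun m => F m (z m)) - Fb x with he1
  have he1' : ‖e1‖ ≤ ℓ * d := hFmean z x hz hxZ
  -- exact extragradient points
  obtain ⟨p, hp⟩ := hproj (x - γ • Fb x)
  obtain ⟨t, ht⟩ := hproj (x - γ • Fb p)
  have hcontr : ‖t - zs‖ ≤ (1 - γ * μ / 2) * r :=
    extragradient_contraction hγ hμ hL hμ4 (hlip x hxZ p hp.1) (hstrong p hp.1 zs hzs)
      (hvi p hp.1) (hp.inner_nonneg hconv ht.1) (ht.inner_nonneg hconv hzs)
  have hhp : ‖hb0 - p‖ ≤ γ * (ℓ * d) := by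
    refine (norm_sub_le_of_inner_nonneg (hhb.inner_nonneg hconv hp.1)
      (hp.inner_nonneg hconv hhb.1)).trans ?_
    have : mean a - (x - γ • Fb x) = -(γ • e1) := by rw [hāeq, he1, smul_sub]; abel
    rw [this, norm_neg, norm_smul, Real.norm_of_nonneg hγ.le]
    gcongr
  have hps : ‖p - zs‖ ≤ 5 / 4 * r := by
    -- By `hvi`, `zs` satisfies the projection inequality for `zs - γ • Fb zs`. Nonexpansiveness
    -- then gives the factor `1 + γ L ≤ 5/4`.
    have h1 : ‖p - zs‖ ≤ ‖x - γ • Fb x - (zs - γ • Fb zs)‖ := by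
      refine norm_sub_le_of_inner_nonneg (hp.inner_nonneg hconv hzs) ?_
      rw [sub_sub_cancel_left, inner_neg_left, ← inner_neg_right, neg_sub, real_inner_smul_left]
      exact mul_nonneg hγ.le (hvi p hp.1)
    refine h1.trans ?_
    have h2 : x - γ • Fb x - (zs - γ • Fb zs) = (x - zs) - γ • (Fb x - Fb zs) := by
      rw [smul_sub]; abel
    rw [h2]
    refine (norm_sub_le _ _).trans ?_
    rw [norm_smul, Real.norm_of_nonneg hγ.le]
    have h3 : γ * ‖Fb x - Fb zs‖ ≤ γ * (L * r) := by gcongr; exact hlip x hxZ zs hzs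
    nlinarith
  -- second half step
  set Db := spread fun m => z m - γ • F m (h m) with hDb
  have hDb0 : 0 ≤ Db := spread_nonneg _
  have hhs : rms (fun m => h m - zs) ≤ ρ * Da + (s * d + 5 / 4 * r) := by
    have h1 := rms_add_le (fun m => h m - hb0) (fun _ => hb0 - zs)
    simp only [sub_add_sub_cancel, rms_const hM] at h1
    have h2 : ‖hb0 - zs‖ ≤ ‖hb0 - p‖ + ‖p - zs‖ := by
      rw [← sub_add_sub_cancel hb0 p zs]; exact norm_add_le _ _
    have h3 : γ * (ℓ * d) = s * d := by rw [hs]; ring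
    linarith
  have hDb1 : Db ≤ d + s * (q + (ρ * Da + (s * d + 5 / 4 * r))) := by
    have h1 := spread_sub_smul_le z (fun m => F m (h m)) hγ.le
    have h2 := hFspread h hhm
    have h4 : γ * spread (fun m => F m (h m)) ≤
        γ * (ℓ * q + ℓ * (ρ * Da + (s * d + 5 / 4 * r))) := by
      gcongr; exact h2.trans (by gcongr)
    calc Db ≤ d + γ * (ℓ * q + ℓ * (ρ * Da + (s * d + 5 / 4 * r))) := h1.trans (by gcongr)
      _ = _ := by rw [hs]; ring
  have hDb2 : Db ≤ 2 * (1 + s) ^ 2 * d + 2 * s * (1 + s) * (q + r) := by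
    have h1 : ρ * Da ≤ (1 + s) * d + s * (q + r) :=
      (mul_le_of_le_one_left hDa0 hρ1).trans hDa1
    have h2 : s * (ρ * Da) ≤ s * ((1 + s) * d + s * (q + r)) := by gcongr
    nlinarith [mul_nonneg hs0.le hq0, mul_nonneg hs0.le hr0, mul_nonneg hs0.le hd0,
      mul_nonneg (sq_nonneg s) hq0, mul_nonneg (sq_nonneg s) hr0]
  obtain ⟨zb, hzb⟩ := hproj (mean b)
  have hz1 : rms (fun m => z' m - zb) ≤ ρ * Db := (rms_proj_sub_le hconv hz' hzb).trans hb'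
  have hbeq : mean b = x - γ • mean fun m => F m (h m) := by
    rw [hb, mean_sub, mean_smul]
  -- The nodes' disagreement at the half points costs `Lmax` but carries `ρ`. The shift from `p` to
  -- `hb0` does not carry `ρ`, but it passes through the averaged operator, so `γ L ≤ 1/4` reduces
  -- it to `s d / 4`.
  have hzbt : ‖zb - t‖ ≤ s * (ρ * Da) + s * d / 4 := by
    refine (norm_sub_le_of_inner_nonneg (hzb.inner_nonneg hconv ht.1)
      (ht.inner_nonneg hconv hzb.1)).trans ?_
    have e : mean b - (x - γ • Fb p) =
        -(γ • (((mean fun m => F m (h m)) - Fb hb0) + (Fb hb0 - Fb p))) := by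
      rw [hbeq, sub_add_sub_cancel, smul_sub]; abel
    rw [e, norm_neg, norm_smul, Real.norm_of_nonneg hγ.le]
    have h1 := hFmean h hb0 hhm hhb.1
    have h2 := hlip hb0 hhb.1 p hp.1
    have h3 : γ * ‖(mean fun m => F m (h m)) - Fb hb0‖ ≤ γ * (ℓ * (ρ * Da)) := by
      gcongr; exact h1.trans (by gcongr)
    have h4 : γ * ‖Fb hb0 - Fb p‖ ≤ s * d / 4 := by
      calc γ * ‖Fb hb0 - Fb p‖ ≤ γ * (L * ‖hb0 - p‖) := by gcongr
        _ = (γ * L) * ‖hb0 - p‖ := by ring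
        _ ≤ 1 / 4 * (γ * (ℓ * d)) := by gcongr
        _ = _ := by rw [hs]; ring
    calc γ * ‖((mean fun m => F m (h m)) - Fb hb0) + (Fb hb0 - Fb p)‖
        ≤ γ * (‖(mean fun m => F m (h m)) - Fb hb0‖ + ‖Fb hb0 - Fb p‖) := by
          gcongr; exact norm_add_le _ _
      _ ≤ γ * (ℓ * (ρ * Da)) + s * d / 4 := by rw [mul_add]; exact add_le_add h3 h4
      _ = _ := by rw [hs]; ring
  refine ⟨?_, ?_⟩
  · exact ((spread_le_rms_sub hM z' zb).trans hz1).trans (by gcongr)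
  · have h1 : ‖mean z' - zs‖ ≤ ‖mean z' - zb‖ + (‖zb - t‖ + ‖t - zs‖) := by
      rw [← sub_add_sub_cancel (mean z') zb zs, ← sub_add_sub_cancel zb t zs]
      exact (norm_add_le _ _).trans (by gcongr; exact norm_add_le _ _)
    have h2 := (norm_mean_sub_le_rms hM z' zb).trans hz1
    have h3 : s * (ρ * Da) ≤ ρ * ((1 + s) ^ 2 * d + s * (1 + s) * (q + r)) := by
      rw [mul_left_comm]
      have : s * Da ≤ s * ((1 + s) * d + s * (q + r)) := by gcongr
      gcongr
      nlinarith [mul_nonneg hs0.le hq0, mul_nonneg hs0.le hr0, mul_nonneg hs0.le hd0]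
    have h4 : ρ * Db ≤ ρ * (2 * (1 + s) ^ 2 * d + 2 * s * (1 + s) * (q + r)) := by gcongr
    linarith

/-- The combined error `r + (1 + s) d` decreases geometrically up to a small constant. -/
theorem potential_step {r d r' d' q s ρ κ : ℝ} (hr : 0 ≤ r) (hd : 0 ≤ d) (hq : 0 ≤ q)
    (hs : 0 ≤ s) (hρ : 0 ≤ ρ) (hκ : κ ≤ 1) (h1 : 5 * ρ * (1 + s) ^ 2 ≤ 1 / 4)
    (h2 : 5 * ρ * s * (1 + s) ^ 2 ≤ κ / 2)
    (hd' : d' ≤ ρ * (2 * (1 + s) ^ 2 * d + 2 * s * (1 + s) * (q + r)))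
    (hr' : r' ≤ (1 - κ) * r + s * d / 4 +
      ρ * (3 * (1 + s) ^ 2 * d + 3 * s * (1 + s) * (q + r))) :
    r' + (1 + s) * d' ≤ (1 - κ / 2) * (r + (1 + s) * d) + 5 * ρ * s * (1 + s) ^ 2 * q := by
  -- The constant 5 is 3 from `r'` plus 2 from `(1 + s) d'`. In `(1 + s) d`, `h4` and `h8` each cost
  -- at most a quarter, and `1/2 ≤ 1 - κ / 2`; in `r`, `h5` spends half of the contraction `κ`.
  have h3 : (1 + s) * d' ≤
      (1 + s) * (ρ * (2 * (1 + s) ^ 2 * d + 2 * s * (1 + s) * (q + r))) := by gcongr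
  have h4 : 5 * ρ * (1 + s) ^ 2 * ((1 + s) * d) ≤ 1 / 4 * ((1 + s) * d) := by gcongr
  have h5 : 5 * ρ * s * (1 + s) ^ 2 * r ≤ κ / 2 * r := by gcongr
  have h6 : 3 * ρ * (1 + s) ^ 2 * d ≤ 3 * ρ * (1 + s) ^ 2 * ((1 + s) * d) := by
    gcongr; nlinarith
  have h7 : 3 * ρ * s * (1 + s) * (q + r) ≤ 3 * ρ * s * (1 + s) ^ 2 * (q + r) := by
    gcongr; nlinarith
  have h8 : s * d / 4 ≤ (1 + s) * d / 4 := by nlinarith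
  have h9 : 0 ≤ (1 - κ) * ((1 + s) * d) := by
    apply mul_nonneg (by linarith); positivity
  nlinarith

/-- `e` is the fixed point of the affine recursion. -/
theorem geometric_bound {V : ℕ → ℝ} {κ e : ℝ} (hκ1 : κ ≤ 1)
    (h : ∀ n, V (n + 1) ≤ (1 - κ) * V n + κ * e) (n : ℕ) (he : 0 ≤ e) :
    V n ≤ (1 - κ) ^ n * V 0 + e := by
  induction n with
  | zero => simp; exact he
  | succ n ih =>
    calc V (n + 1) ≤ (1 - κ) * V n + κ * e := h n
      _ ≤ (1 - κ) * ((1 - κ) ^ n * V 0 + e) + κ * e := by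
        gcongr
      _ = _ := by ring

end Step

/-! ### Convergence of the method for an abstract operator -/

section Method

variable {M : ℕ} {E : Type*} [NormedAddCommGroup E] [InnerProductSpace ℝ E]

theorem method_succ (Z : Set E) (F : Fin M → E → E) (G : ℕ → SimpleGraph (Fin M)) (η β γ : ℝ)
    (H : ℕ) (z₀ : E) (N : ℕ) :
    method Z F G η β γ H z₀ (N + 1) = methodStep Z F G η β γ H (method Z F G η β γ H z₀ N) := by
  rw [method, Function.iterate_succ_apply', method]

theorem method_rounds (Z : Set E) (F : Fin M → E → E) (G : ℕ → SimpleGraph (Fin M)) (η β γ : ℝ)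
    (H : ℕ) (z₀ : E) (N : ℕ) : (method Z F G η β γ H z₀ N).rounds = 2 * N * H := by
  induction N with
  | zero => simp [method]
  | succ N ih =>
    rw [method_succ]
    simp only [methodStep, accGossip_round, ih]
    ring

theorem method_calls (Z : Set E) (F : Fin M → E → E) (G : ℕ → SimpleGraph (Fin M)) (η β γ : ℝ)
    (H : ℕ) (z₀ : E) (N : ℕ) : (method Z F G η β γ H z₀ N).calls = 2 * N := by
  induction N with
  | zero => simp [method]
  | succ N ih =>
    rw [method_succ]
    simp only [methodStep, ih]
    ring

theorem method_mem {Z : Set E} (hproj : ∀ x, IsProj Z x (proj Z x)) (F : Fin M → E → E)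
    (G : ℕ → SimpleGraph (Fin M)) (η β γ : ℝ) (H : ℕ) {z₀ : E} (hz₀ : z₀ ∈ Z) (N : ℕ)
    (m : Fin M) : (method Z F G η β γ H z₀ N).z m ∈ Z := by
  cases N with
  | zero => exact hz₀
  | succ N => rw [method_succ]; exact (hproj _).1

/-- Linear convergence of the method up to an error proportional to the gossip accuracy `ρ`. -/
theorem method_error_le {Z : Set E} (hconv : Convex ℝ Z) (hM : 0 < M)
    (hproj : ∀ x, IsProj Z x (proj Z x))
    {F : Fin M → E → E} {L ℓ μ γ ρ : ℝ} {zs z₀ : E} (hγ : 0 < γ) (hμ : 0 < μ) (hℓ : 0 < ℓ)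
    (hρ : 0 ≤ ρ) (hL : γ * L ≤ 1 / 4) (hμ4 : γ * μ ≤ 1 / 4)
    (hlip : ∀ x ∈ Z, ∀ y ∈ Z,
      ‖(mean fun m => F m x) - mean fun m => F m y‖ ≤ L * ‖x - y‖)
    (hlip' : ∀ m, ∀ x ∈ Z, ∀ y ∈ Z, ‖F m x - F m y‖ ≤ ℓ * ‖x - y‖)
    (hstrong : ∀ x ∈ Z, ∀ y ∈ Z,
      μ * ‖x - y‖ ^ 2 ≤ inner ℝ ((mean fun m => F m x) - mean fun m => F m y) (x - y))
    (hzs : zs ∈ Z) (hvi : ∀ x ∈ Z, 0 ≤ inner ℝ (mean fun m => F m zs) (x - zs)) (hz₀ : z₀ ∈ Z)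
    {G : ℕ → SimpleGraph (Fin M)} {η β : ℝ} {H : ℕ}
    (hgossip : ∀ k₀ (z : Fin M → E), spread (accGossip G η β H k₀ z).z ≤ ρ * spread z)
    {q : ℝ} (hq : ℓ * q = rms fun m => F m zs)
    (h1 : 20 * ρ * (1 + γ * ℓ) ^ 2 ≤ 1) (h2 : 20 * ρ * (ℓ / μ) * (1 + γ * ℓ) ^ 2 ≤ 1) (N : ℕ) :
    ‖mean (method Z F G η β γ H z₀ N).z - zs‖ +
        (1 + γ * ℓ) * spread (method Z F G η β γ H z₀ N).z ≤
      (1 - γ * μ / 4) ^ N * ‖z₀ - zs‖ + 20 * ρ * (ℓ / μ) * (1 + γ * ℓ) ^ 2 * q := by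
  set s := γ * ℓ with hs
  have hs0 : 0 < s := by positivity
  have hq0 : 0 ≤ q := nonneg_of_mul_nonneg_right (hq ▸ rms_nonneg _) hℓ
  have hγμ : 0 < γ * μ := by positivity
  have hρ1 : ρ ≤ 1 := by nlinarith [mul_nonneg hρ hs0.le, mul_nonneg hρ (sq_nonneg s)]
  set V : ℕ → ℝ := fun N => ‖mean (method Z F G η β γ H z₀ N).z - zs‖ +
    (1 + s) * spread (method Z F G η β γ H z₀ N).z with hV
  have hmem := method_mem hproj F G η β γ H hz₀
  have hV0 : V 0 = ‖z₀ - zs‖ := by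
    simp [hV, method, mean_const hM, spread, rms_const hM]
  have hstep : ∀ n, V (n + 1) ≤ (1 - γ * μ / 4) * V n +
      γ * μ / 4 * (20 * ρ * (ℓ / μ) * (1 + s) ^ 2 * q) := by
    intro n
    set st := method Z F G η β γ H z₀ n
    set g₁ := accGossip G η β H st.rounds fun m => st.z m - γ • F m (st.z m)
    obtain ⟨hd, hr⟩ := decentralized_step hconv hM (fun x => ⟨_, hproj x⟩) (fun _ => rfl) hγ hμ hℓ
      hρ hρ1 hL hμ4 hlip hlip' hstrong hzs hvi (hmem n) (mean_accGossip G η β H st.rounds _).2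
      (hgossip st.rounds _) (fun m => hproj (g₁.z m))
      (mean_accGossip G η β H g₁.round _).2 (hgossip g₁.round _)
      (fun m => by rw [method_succ]; exact hproj _) hq hs
      (z' := (method Z F G η β γ H z₀ (n + 1)).z)
    have e : γ * μ / 2 / 2 = γ * μ / 4 := by ring
    -- With `κ = γμ/2` the sum contracts by `1 - γμ/4`. Writing the residual `5 ρ s (1 + s)² q` as
    -- `γμ/4` times a constant produces the 20 and the ratio `ℓ / μ`.
    have hp := potential_step (norm_nonneg _) (spread_nonneg _) hq0 hs0.le hρ (by linarith)
      (by linarith) (κ := γ * μ / 2) (by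
        calc 5 * ρ * s * (1 + s) ^ 2 =
            γ * μ / 2 / 2 * (20 * ρ * (ℓ / μ) * (1 + s) ^ 2) := by
              rw [hs]; field_simp; ring
          _ ≤ γ * μ / 2 / 2 * 1 := by gcongr
          _ = _ := mul_one _) hd hr
    rw [e] at hp
    refine hp.trans (le_of_eq ?_)
    congr 1
    rw [hs]; field_simp; ring
  have := geometric_bound (V := V) (by linarith) hstep N (by positivity)
  rwa [hV0] at this

end Method

/-! ### Optimality condition of the saddle point problem -/

section Optimality

variable {M : ℕ} {E : Type*} [NormedAddCommGroup E] [InnerProductSpace ℝ E]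

theorem inner_mean (x : Fin M → E) (v : E) :
    inner ℝ (mean x) v = (M : ℝ)⁻¹ * ∑ m, inner ℝ (x m) v := by
  rw [mean, real_inner_smul_left, sum_inner]

theorem inner_gradient_nonneg_of_min [CompleteSpace E] {S : Set E} (hS : Convex ℝ S)
    {g : Fin M → E → ℝ} {x y : E} (hx : x ∈ S) (hy : y ∈ S)
    (hg : ∀ m, DifferentiableAt ℝ (g m) x)
    (hmin : ∀ w ∈ S, (M : ℝ)⁻¹ * ∑ m, g m x ≤ (M : ℝ)⁻¹ * ∑ m, g m w) :
    0 ≤ (M : ℝ)⁻¹ * ∑ m, inner ℝ (gradient (g m) x) (y - x) := by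
  have hd : HasFDerivAt (fun w => (M : ℝ)⁻¹ * ∑ m, g m w)
      ((M : ℝ)⁻¹ • ∑ m, fderiv ℝ (g m) x) x :=
    (HasFDerivAt.fun_sum fun m _ => (hg m).hasFDerivAt).const_mul _
  have hloc : IsLocalMinOn (fun w => (M : ℝ)⁻¹ * ∑ m, g m w) S x :=
    IsMinOn.localize fun w hw => hmin w hw
  have := hloc.hasFDerivWithinAt_nonneg hd.hasFDerivWithinAt
    (sub_mem_posTangentConeAt_of_segment_subset (hS.segment_subset hx hy))
  simpa [gradient, InnerProductSpace.toDual_symm_apply] using this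

/-- A saddle point minimizes `f` in `x` and `-f` in `y`, each with the other variable frozen. The
sum of the two first-order conditions is the variational inequality for `Fbar`. -/
theorem SaddleProblem.inner_Fbar_nonneg {nx ny : ℕ} {P : SaddleProblem M nx ny} {L Lmax μ : ℝ}
    (hP : P.Regular L Lmax μ) {zs : Pt nx ny} (hs : P.IsSolution zs) {z : Pt nx ny}
    (hz : z ∈ P.Z) : 0 ≤ inner ℝ (P.Fbar zs) (z - zs) := by
  obtain ⟨⟨hxs, hys⟩, hopt⟩ := hs
  have h1 := inner_gradient_nonneg_of_min hP.convex_X hxs hz.1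
    (g := fun m x => P.f m x zs.snd) (fun m => hP.diff_x m _ hxs _ hys)
    fun x hx => (hopt x hx _ hys).2
  have h2 := inner_gradient_nonneg_of_min hP.convex_Y hys hz.2
    (g := fun m y => -P.f m zs.fst y) (fun m => (hP.diff_y m _ hxs _ hys).neg)
    fun y hy => by
      have := (hopt _ hxs y hy).1
      simp only [SaddleProblem.obj] at this
      simp only [Finset.sum_neg_distrib]
      linarith
  have h3 : ∀ m, gradient (fun y => -P.f m zs.fst y) zs.snd =
      -gradient (fun y => P.f m zs.fst y) zs.snd := fun m => by
    simp only [gradient, fderiv_fun_neg, map_neg]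
  simp only [h3] at h2
  rw [SaddleProblem.Fbar, inner_mean]
  have h4 : ∀ m, inner ℝ (P.F m zs) (z - zs) =
      inner ℝ (gradient (fun x => P.f m x zs.snd) zs.fst) (z.fst - zs.fst) +
        inner ℝ (-gradient (fun y => P.f m zs.fst y) zs.snd) (z.snd - zs.snd) := fun m => by
    rw [WithLp.prod_inner_apply]; rfl
  simp only [h4, Finset.sum_add_distrib, mul_add]
  exact add_nonneg h1 h2

end Optimality

/-! ### Numerical estimates -/

section Estimates

theorem le_log_of_two_le {x : ℝ} (hx : 2 ≤ x) : 0.69 ≤ Real.log x := by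
  have := Real.log_two_gt_d9
  have := Real.log_le_log (by norm_num) hx
  linarith

/-- A number of gossip steps that makes the gossip factor at most `√ε / B ^ 10`. -/
theorem gossip_factor_le {χ ε B : ℝ} {H : ℕ} (hχ : 1 ≤ χ) (hε : 0 < ε) (hε2 : ε ≤ 1 / 2)
    (hB : 2 ≤ B)
    (hH : 40 * Real.log B * (√χ * max 1 (Real.log χ) * Real.log (1 / ε)) ≤ H) :
    (χ + 1) * (1 - (√χ)⁻¹) ^ H ≤ ε / B ^ 20 := by
  set b := Real.log B with hb
  set l := Real.log (1 / ε) with hl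
  set X := max 1 (Real.log χ) with hX
  have hb0 : 0.69 ≤ b := le_log_of_two_le hB
  have hl0 : 0.69 ≤ l :=
    le_log_of_two_le (by rw [le_div_iff₀ hε]; linarith)
  have hX1 : 1 ≤ X := le_max_left _ _
  have hs : 1 ≤ √χ := Real.one_le_sqrt.mpr hχ
  have hs0 : 0 < √χ := by linarith
  have hinv : (√χ)⁻¹ ≤ 1 := inv_le_one_of_one_le₀ hs
  have h1 : (1 - (√χ)⁻¹) ^ H ≤ Real.exp (-(H * (√χ)⁻¹)) := by
    calc (1 - (√χ)⁻¹) ^ H ≤ Real.exp (-(√χ)⁻¹) ^ H :=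
          pow_le_pow_left₀ (by linarith) (Real.one_sub_le_exp_neg _) H
      _ = _ := by rw [← Real.exp_nat_mul]; ring_nf
  have h2 : 40 * b * X * l ≤ H * (√χ)⁻¹ := by
    rw [← div_eq_mul_inv, le_div_iff₀ hs0]; linarith
  have h3 : χ + 1 ≤ Real.exp (b + X) := by
    have hχX : χ ≤ Real.exp X := by
      rw [← Real.exp_log (by linarith : 0 < χ)]
      exact Real.exp_le_exp.mpr (le_max_right _ _)
    rw [Real.exp_add, hb, Real.exp_log (by linarith)]
    nlinarith
  have h4 : ε / B ^ 20 = Real.exp (-(l + 20 * b)) := by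
    rw [neg_add, Real.exp_add, Real.exp_neg, Real.exp_neg, hl, Real.exp_log (by positivity),
      show (20 : ℝ) * b = (20 : ℕ) * b by norm_num, Real.exp_nat_mul, hb,
      Real.exp_log (by linarith)]
    field_simp
  -- Of the `21 * b`, one `b` pays for `χ + 1 ≤ B * exp X` and twenty for `B ^ 20`. The product
  -- dominates the sum because `b`, `X`, `l` are all at least `0.69`.
  have h5 : X + l + 21 * b ≤ 40 * b * X * l := by
    have hXl : 0.69 ≤ X * l := by nlinarith
    have hbl : 0.69 * 0.69 ≤ b * l := by nlinarith
    have hbX : 0.69 ≤ b * X := by nlinarith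
    have e1 : 0.69 * b ≤ b * (X * l) := by nlinarith
    have e2 : 0.69 * l ≤ b * X * l := by nlinarith
    have e3 : 0.69 * 0.69 * X ≤ b * l * X := by nlinarith
    nlinarith
  rw [h4]
  calc (χ + 1) * (1 - (√χ)⁻¹) ^ H ≤ Real.exp (b + X) * Real.exp (-(H * (√χ)⁻¹)) := by
        gcongr
    _ = Real.exp (b + X - H * (√χ)⁻¹) := by rw [← Real.exp_add, ← sub_eq_add_neg]
    _ ≤ _ := Real.exp_le_exp.mpr (by linarith)

/-- A number of iterations that makes the initial error at most `√ε / 2`. -/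
theorem iteration_factor_le {D ε t : ℝ} {N : ℕ} (hD : 0 ≤ D) (hε : 0 < ε) (hε2 : ε ≤ 1 / 2)
    (ht : 0 < t) (ht4 : t ≤ 1 / 4)
    (hN : 40 * Real.log (2 + D ^ 2) * (1 / t * Real.log (1 / ε)) ≤ N) :
    (1 - t / 4) ^ N * D ≤ √ε / 2 := by
  set a := Real.log (2 + D ^ 2) with ha
  set l := Real.log (1 / ε) with hl
  have ha0 : Real.log 2 ≤ a := Real.log_le_log (by norm_num) (by nlinarith)
  have ha1 : 0.69 ≤ a := le_log_of_two_le (by nlinarith)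
  have hl0 : 0.69 ≤ l :=
    le_log_of_two_le (by rw [le_div_iff₀ hε]; linarith)
  have h1 : (1 - t / 4) ^ N ≤ Real.exp (-(N * (t / 4))) := by
    calc (1 - t / 4) ^ N ≤ Real.exp (-(t / 4)) ^ N :=
          pow_le_pow_left₀ (by linarith) (Real.one_sub_le_exp_neg _) N
      _ = _ := by rw [← Real.exp_nat_mul]; ring_nf
  have h2 : 10 * a * l ≤ N * (t / 4) := by
    have : 40 * a * (1 / t * l) * (t / 4) = 10 * a * l := by field_simp; ring
    rw [← this]
    gcongr
  have h3 : D ≤ Real.exp a := by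
    rw [ha, Real.exp_log (by positivity)]; nlinarith [sq_nonneg (D - 1)]
  have h4 : √ε = Real.exp (-(l / 2)) := by
    rw [Real.sqrt_eq_iff_mul_self_eq hε.le (Real.exp_pos _).le, ← Real.exp_add, ← neg_add,
      add_halves, Real.exp_neg, hl, Real.exp_log (by positivity), one_div, inv_inv]
  -- One factor `exp (-a) ≤ 1/2` supplies the halving; another copy of `a` absorbs `D ≤ exp a`.
  have h5 : Real.exp (-(l / 2) - a) ≤ √ε / 2 := by
    rw [Real.exp_sub, ← h4]
    gcongr
    rw [← Real.exp_log (by norm_num : (0 : ℝ) < 2)]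
    exact Real.exp_le_exp.mpr ha0
  refine le_trans ?_ h5
  calc (1 - t / 4) ^ N * D ≤ Real.exp (-(N * (t / 4))) * Real.exp a := by gcongr
    _ = Real.exp (-(N * (t / 4)) + a) := by rw [← Real.exp_add]
    _ ≤ _ := Real.exp_le_exp.mpr (by nlinarith)

/-- Smallness conditions implied by a gossip factor of at most `√ε / B ^ 10`. -/
theorem small_of_le_div_pow {ρ ε B K S q : ℝ} (hρ0 : 0 ≤ ρ) (hρ : ρ ≤ √ε / B ^ 10)
    (hε : 0 < ε) (hε2 : ε ≤ 1 / 2)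
    (hB : 2 ≤ B) (hK : K ≤ B) (hS0 : 0 ≤ S) (hS : S ≤ B) (hq0 : 0 ≤ q)
    (hq : q ≤ B) :
    20 * ρ * S ^ 2 ≤ 1 ∧ 20 * ρ * K * S ^ 2 ≤ 1 ∧ 20 * ρ * K * S ^ 2 * q ≤ √ε / 2 := by
  have hB0 : 0 < B := by linarith
  have hε1 : √ε ≤ 1 := Real.sqrt_le_one.mpr (by linarith)
  have hρB : ρ * B ^ 10 ≤ √ε := (le_div_iff₀ (by positivity)).mp hρ
  have h2 : (40 : ℝ) ≤ B ^ 6 :=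
    le_trans (by norm_num) (pow_le_pow_left₀ (by norm_num) hB 6)
  have hB1 : 1 ≤ B := by linarith
  -- The exponent 10 splits as 4 for the problem quantities, with `K * S ^ 2 * q ≤ B ^ 4`, and 6 for
  -- the constant, as `B ^ 6 ≥ 40`.
  have key : ∀ x : ℝ, x ≤ B ^ 4 → 40 * ρ * x ≤ √ε := fun x hx => by
    calc 40 * ρ * x ≤ 40 * ρ * B ^ 4 := by gcongr
      _ ≤ B ^ 6 * ρ * B ^ 4 := by gcongr
      _ = ρ * B ^ 10 := by ring
      _ ≤ √ε := hρB
  have hS2 : S ^ 2 ≤ B ^ 4 :=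
    (pow_le_pow_left₀ hS0 hS 2).trans (pow_le_pow_right₀ hB1 (by norm_num))
  have hKS : K * S ^ 2 ≤ B ^ 4 := by
    calc K * S ^ 2 ≤ B * B ^ 2 := by gcongr
      _ = B ^ 3 := by ring
      _ ≤ B ^ 4 := pow_le_pow_right₀ hB1 (by norm_num)
  have hKSq : K * S ^ 2 * q ≤ B ^ 4 := by
    calc K * S ^ 2 * q ≤ B * B ^ 2 * B := by gcongr
      _ = B ^ 4 := by ring
  have k1 := key _ hS2
  have k2 := key _ hKS
  have k3 := key _ hKSq
  refine ⟨?_, ?_, ?_⟩ <;> linarith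

end Estimates

/-! ### The decentralized extragradient method -/

section Main

variable {M nx ny : ℕ} {P : SaddleProblem M nx ny} {L Lmax μ : ℝ}

theorem SaddleProblem.Regular.isClosed_Z (hP : P.Regular L Lmax μ) : IsClosed P.Z := by
  have h1 : Continuous fun z : Pt nx ny => z.fst := WithLp.prod_continuous_ofLp 2 _ _ |>.fst
  have h2 : Continuous fun z : Pt nx ny => z.snd := WithLp.prod_continuous_ofLp 2 _ _ |>.snd
  exact (hP.closed_X.preimage h1).inter (hP.closed_Y.preimage h2)

theorem SaddleProblem.Regular.convex_Z (hP : P.Regular L Lmax μ) : Convex ℝ P.Z :=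
  fun _ hz _ hw _ _ ha hb hab =>
    ⟨hP.convex_X hz.1 hw.1 ha hb hab, hP.convex_Y hz.2 hw.2 ha hb hab⟩

theorem SaddleProblem.Regular.isProj_proj (hP : P.Regular L Lmax μ) {z₀ : Pt nx ny}
    (hz₀ : z₀ ∈ P.Z) (z : Pt nx ny) : IsProj P.Z z (proj P.Z z) :=
  proj_spec ⟨z₀, hz₀⟩ hP.isClosed_Z.isComplete hP.convex_Z z

/-- Unless the constraint set is a single point, the modulus of strong monotonicity is at most
the Lipschitz constant. -/
theorem SaddleProblem.Regular.mu_le (hP : P.Regular L Lmax μ) {z w : Pt nx ny} (hz : z ∈ P.Z)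
    (hw : w ∈ P.Z) (hne : z ≠ w) : μ ≤ L := by
  have h0 : 0 < ‖z - w‖ := norm_pos_iff.mpr (sub_ne_zero.mpr hne)
  have h1 := hP.strong z hz w hw
  have h2 := real_inner_le_norm (P.Fbar z - P.Fbar w) (z - w)
  have h3 := mul_le_mul_of_nonneg_right (hP.smooth z hz w hw) h0.le
  have h4 : μ * ‖z - w‖ ^ 2 ≤ L * ‖z - w‖ ^ 2 := by nlinarith
  exact le_of_mul_le_mul_right h4 (by positivity)

theorem spread_eq_zero_of_eq_one {E : Type*} [NormedAddCommGroup E] [InnerProductSpace ℝ E]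
    (hM : M = 1) (z : Fin M → E) : spread z = 0 := by
  subst hM
  have h : ∀ m, z m - mean z = 0 := fun m => by
    simp [mean, Subsingleton.elim m 0]
  have := rms_const one_pos (0 : E)
  simpa [spread, h] using this

/-- Gossip multiplies the spread by a factor that is small once `H` is large. -/
theorem exists_gossip_factor {E : Type*} [NormedAddCommGroup E] [InnerProductSpace ℝ E]
    {G : ℕ → SimpleGraph (Fin M)} {lmin lmax : ℝ}
    (hG : HasConnectedSkeleton G lmin lmax) {ε B : ℝ} {H : ℕ} (hε : 0 < ε) (hε2 : ε ≤ 1 / 2)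
    (hB : 2 ≤ B)
    (hH : M = 1 ∨ 40 * Real.log B * (√(lmax / lmin) * max 1 (Real.log (lmax / lmin)) *
      Real.log (1 / ε)) ≤ H) :
    ∃ ρ : ℝ, 0 ≤ ρ ∧ ρ ≤ √ε / B ^ 10 ∧ ∀ k₀ (z : Fin M → E),
      spread (accGossip G (1 / lmax)
        ((√(lmax / lmin) - 1) / (√(lmax / lmin) + 1)) H k₀ z).z ≤ ρ * spread z := by
  -- A single node has no disagreement, so `ρ = 0` works for every `H`; here `χ ≥ 1` may fail.
  by_cases hM : M = 1
  · exact ⟨0, le_rfl, by positivity, fun k₀ z => by simp [spread_eq_zero_of_eq_one hM]⟩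
  · have hM0 : 0 < M := by
      obtain ⟨-, Ghat, hconn, -⟩ := hG
      exact Fin.pos_iff_nonempty.mpr hconn.nonempty
    have hle := hG.lmin_le_lmax (by omega)
    have hχ : 1 ≤ lmax / lmin := (one_le_div hG.1).mpr hle
    have hfac := gossip_factor_le hχ hε hε2 hB (hH.resolve_left hM)
    refine ⟨√ε / B ^ 10, by positivity, le_rfl, fun k₀ z => ?_⟩
    have h := (norm_dev_accGossip_sq_le hG hle H k₀ z).trans
      (mul_le_mul_of_nonneg_right hfac (sq_nonneg _))
    have e : ε / B ^ 20 * ‖dev z‖ ^ 2 = (√ε / B ^ 10 * ‖dev z‖) ^ 2 := by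
      rw [mul_pow, div_pow, Real.sq_sqrt hε.le]; ring
    rw [e, sq_le_sq₀ (norm_nonneg _) (by positivity)] at h
    rw [spread_eq, spread_eq, mul_left_comm]
    gcongr

theorem isEpsSolution_of_forall_eq {zs : Pt nx ny} {ε : ℝ} (hM : 0 < M) (hε : 0 < ε)
    {z : Fin M → Pt nx ny} (h : ∀ m, z m = zs) : IsEpsSolution zs ε z := by
  obtain rfl : z = fun _ => zs := funext h
  rw [IsEpsSolution, mean_const hM]
  simp [hε.le]

theorem isEpsSolution_of_add_le {zs : Pt nx ny} {ε s : ℝ} (hε : 0 < ε) (hs : 0 ≤ s)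
    {z : Fin M → Pt nx ny} (h : ‖mean z - zs‖ + (1 + s) * spread z ≤ √ε) :
    IsEpsSolution zs ε z := by
  have h1 := spread_nonneg z
  have h2 := norm_nonneg (mean z - zs)
  have h3 : 0 ≤ s * spread z := mul_nonneg hs h1
  have h4 : ‖mean z - zs‖ ≤ √ε := by linarith
  have h5 : spread z ≤ √ε := by linarith
  have h6 := rms_sq fun m => z m - mean z
  have h7 := pow_le_pow_left₀ h2 h4 2
  have h8 := pow_le_pow_left₀ h1 h5 2
  rw [Real.sq_sqrt hε.le] at h7 h8
  exact ⟨h7, h6 ▸ h8⟩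

/-- The argument `B` of the logarithm dominates all quantities multiplying `ρ`: `Lmax / μ`, `Q /
Lmax` and `1 + γ * Lmax`. The last bound uses `γ μ ≤ 1/4`, so `B` need not depend on `γ`. -/
theorem desm_isEpsSolution {G : ℕ → SimpleGraph (Fin M)} {lmin lmax : ℝ} {z₀ zs : Pt nx ny}
    {ε γ : ℝ} {H N : ℕ} (hP : P.Regular L Lmax μ) (hG : HasConnectedSkeleton G lmin lmax)
    (hz₀ : z₀ ∈ P.Z) (hs : P.IsSolution zs) (hε : 0 < ε) (hε2 : ε ≤ 1 / 2)
    (hμL : μ ≤ L) (hγ : 0 < γ) (hγL : γ ≤ 1 / (4 * L))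
    (hH : M = 1 ∨ 40 * Real.log (2 + ‖z₀ - zs‖ ^ 2 + ((M : ℝ)⁻¹ * ∑ m, ‖P.F m zs‖ ^ 2) / Lmax ^ 2 +
      Lmax / μ) * (√(lmax / lmin) * max 1 (Real.log (lmax / lmin)) * Real.log (1 / ε)) ≤ H)
    (hN : 40 * Real.log (2 + ‖z₀ - zs‖ ^ 2) * (1 / (γ * μ) * Real.log (1 / ε)) ≤ N) :
    IsEpsSolution zs ε (desm P G lmin lmax γ H z₀ N).z := by
  have hM : 0 < M := by
    obtain ⟨-, Ghat, hconn, -⟩ := hG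
    exact Fin.pos_iff_nonempty.mpr hconn.nonempty
  have hL := hP.L_pos
  have hℓ := hP.Lmax_pos
  have hμ := hP.mu_pos
  have hγL' : γ * L ≤ 1 / 4 := by
    rw [le_div_iff₀ (by positivity)] at hγL; linarith
  have hγμ : γ * μ ≤ 1 / 4 := (by gcongr : γ * μ ≤ γ * L).trans hγL'
  set Q := rms fun m => P.F m zs with hQ
  have hQ0 : 0 ≤ Q := rms_nonneg _
  rw [← rms_sq] at hH
  set B := 2 + ‖z₀ - zs‖ ^ 2 + Q ^ 2 / Lmax ^ 2 + Lmax / μ with hBdef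
  have hR0 : 0 ≤ ‖z₀ - zs‖ ^ 2 := by positivity
  have hQ2 : 0 ≤ Q ^ 2 / Lmax ^ 2 := by positivity
  have hK0 : 0 ≤ Lmax / μ := by positivity
  have hB : 2 ≤ B := by linarith
  have hKB : Lmax / μ ≤ B := by linarith
  have hqB : Q / Lmax ≤ B := by
    rw [← div_pow] at hQ2 hBdef
    nlinarith [sq_nonneg (Q / Lmax - 1)]
  have hSB : 1 + γ * Lmax ≤ B := by
    have : γ * Lmax ≤ 1 / 4 * (Lmax / μ) := by
      have e : γ * Lmax = γ * μ * (Lmax / μ) := by field_simp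
      rw [e]; gcongr
    linarith
  obtain ⟨ρ, hρ0, hρ, hgossip⟩ := exists_gossip_factor (E := Pt nx ny) hG hε hε2 hB hH
  obtain ⟨h1, h2, h3⟩ := small_of_le_div_pow hρ0 hρ hε hε2 hB hKB
    (by positivity : 0 ≤ 1 + γ * Lmax) hSB (by positivity : 0 ≤ Q / Lmax) hqB
  have hmain := method_error_le hP.convex_Z hM (hP.isProj_proj hz₀) hγ hμ hℓ hρ0 hγL' hγμ
    hP.smooth hP.smooth_local hP.strong hs.1 (fun x hx => SaddleProblem.inner_Fbar_nonneg hP hs hx)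
    hz₀ hgossip (by rw [← hQ]; field_simp : Lmax * (Q / Lmax) = rms fun m => P.F m zs) h1 h2 N
  have h4 := iteration_factor_le (norm_nonneg (z₀ - zs)) hε hε2 (by positivity) hγμ hN
  have h5 := hmain.trans (add_le_add h4 h3)
  rw [add_halves] at h5
  exact isEpsSolution_of_add_le hε (by positivity) h5

end Main

end MinMaxGossip

/-! ### The main theorem: choice of the constant and degenerate cases -/

open MinMaxGossip in
theorem mainTheorem3 :
    ∃ C : ℝ, 0 < C ∧
      ∀ (M nx ny : ℕ) (P : MinMaxGossip.SaddleProblem M nx ny) (L Lmax μ : ℝ)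
        (G : ℕ → SimpleGraph (Fin M)) (lmin lmax : ℝ)
        (z₀ zs : MinMaxGossip.Pt nx ny) (ε : ℝ),
        P.Regular L Lmax μ →
        MinMaxGossip.HasConnectedSkeleton G lmin lmax →
        z₀ ∈ P.Z → P.IsSolution zs →
        0 < ε → ε ≤ 1 / 2 →
        let χ : ℝ := lmax / lmin
        let R2 : ℝ := ‖z₀ - zs‖ ^ 2
        let Q2 : ℝ := (M : ℝ)⁻¹ * ∑ m, ‖P.F m zs‖ ^ 2
        let a : ℝ := Real.log (2 + R2)
        let b : ℝ := Real.log (2 + R2 + Q2 / Lmax ^ 2 + Lmax / μ)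
        -- every sufficiently long run with a sufficiently long gossip phase
        (∀ (γ : ℝ) (H N : ℕ), 0 < γ → γ ≤ 1 / (4 * L) →
          C * b * (Real.sqrt χ * max 1 (Real.log χ) * Real.log (1 / ε)) ≤ H →
          C * a * (1 / (γ * μ) * Real.log (1 / ε)) ≤ N →
          MinMaxGossip.IsEpsSolution zs ε
            (MinMaxGossip.desm P G lmin lmax γ H z₀ N).z) ∧
        -- the resulting complexities, for the step size `1 / (4 L)`
        (∃ H N : ℕ,
          (H : ℝ) ≤ C * b * (Real.sqrt χ * max 1 (Real.log χ) * Real.log (1 / ε)) ∧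
          MinMaxGossip.IsEpsSolution zs ε
            (MinMaxGossip.desm P G lmin lmax (1 / (4 * L)) H z₀ N).z ∧
          ((MinMaxGossip.desm P G lmin lmax (1 / (4 * L)) H z₀ N).rounds : ℝ) ≤
            C * a * b *
              (Real.sqrt χ * max 1 (Real.log χ) * (L / μ) * Real.log (1 / ε) ^ 2) ∧
          ((MinMaxGossip.desm P G lmin lmax (1 / (4 * L)) H z₀ N).calls : ℝ) ≤
            C * a * (L / μ * Real.log (1 / ε))) := by
  -- `14432 = 2 * 164 * 44`: two gossip phases per iteration, with `N ≤ 164 (…)` and `H ≤ 44 (…)`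
  -- below.
  refine ⟨14432, by norm_num, ?_⟩
  intro M nx ny P L Lmax μ G lmin lmax z₀ zs ε hP hG hz₀ hs hε hε2 χ R2 Q2 a b
  have hM : 0 < M := by
    obtain ⟨-, Ghat, hconn, -⟩ := hG
    exact Fin.pos_iff_nonempty.mpr hconn.nonempty
  have hL := hP.L_pos
  have hℓ := hP.Lmax_pos
  have hμ := hP.mu_pos
  have hR2 : 0 ≤ R2 := sq_nonneg _
  have hQ2 : 0 ≤ Q2 :=
    mul_nonneg (by positivity) (Finset.sum_nonneg fun m _ => sq_nonneg _)
  have hrounds : ∀ γ H N, ((desm P G lmin lmax γ H z₀ N).rounds : ℝ) = 2 * N * H := by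
    intro γ H N
    rw [desm, method_rounds]; push_cast; ring
  have hcalls : ∀ γ H N, ((desm P G lmin lmax γ H z₀ N).calls : ℝ) = 2 * N := by
    intro γ H N
    rw [desm, method_calls]; push_cast; ring
  have hmain : ∀ γ H N, μ ≤ L → 0 < γ → γ ≤ 1 / (4 * L) →
      (M = 1 ∨ 40 * b * (√χ * max 1 (Real.log χ) * Real.log (1 / ε)) ≤ (H : ℕ)) →
      40 * a * (1 / (γ * μ) * Real.log (1 / ε)) ≤ (N : ℕ) →
      IsEpsSolution zs ε (desm P G lmin lmax γ H z₀ N).z :=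
    fun γ H N hμL hγ hγL hH hN => desm_isEpsSolution hP hG hz₀ hs hε hε2 hμL hγ hγL hH hN
  have ha : 0.69 ≤ a := le_log_of_two_le (le_add_of_nonneg_right hR2)
  have hb : 0.69 ≤ b := le_log_of_two_le <|
    ((le_add_of_nonneg_right hR2).trans (le_add_of_nonneg_right
      (div_nonneg hQ2 (sq_nonneg _)))).trans (le_add_of_nonneg_right (div_pos hℓ hμ).le)
  have hχ : M ≠ 1 → 1 ≤ √χ := fun hM1 =>
    Real.one_le_sqrt.mpr ((one_le_div hG.1).mpr (hG.lmin_le_lmax (by omega)))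
  clear_value a b R2 Q2 χ
  set l := Real.log (1 / ε) with hl
  have hl0 : 0.69 ≤ l :=
    le_log_of_two_le (by rw [le_div_iff₀ hε]; linarith)
  set X := max 1 (Real.log χ) with hX
  have hX1 : 1 ≤ X := le_max_left _ _
  have hs0 : 0 ≤ √χ := Real.sqrt_nonneg _
  -- Only a second point of `Z` forces `μ ≤ L`. If `Z` is the single point `zs`, every iterate
  -- equals `zs`, and `N = H = 0` meets all the bounds.
  by_cases hsub : ∃ z ∈ P.Z, z ≠ zs
  · obtain ⟨z, hz, hne⟩ := hsub
    have hμL : μ ≤ L := hP.mu_le hz hs.1 hne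
    constructor
    · intro γ H N hγ hγL hH hN
      refine hmain γ H N hμL hγ hγL (Or.inr (le_trans ?_ hH)) (le_trans ?_ hN)
      · gcongr
        norm_num
      · gcongr
        norm_num
    · have hLμ : 1 ≤ L / μ := (one_le_div hμ).mpr hμL
      have hal : 0.47 ≤ a * l := by nlinarith
      have halL : 0.47 ≤ a * l * (L / μ) := by nlinarith
      obtain ⟨N, hN1, hN2⟩ : ∃ N : ℕ, 40 * a * (1 / (1 / (4 * L) * μ) * l) ≤ N ∧
          (N : ℝ) ≤ 164 * (a * l * (L / μ)) := by
        -- `160 = 40 * 4` from `γ = 1 / (4 * L)`; the `+ 1` of rounding up is absorbed because `4 *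
        -- 0.47 ≥ 1`, with `0.47 ≤ 0.69 ^ 2`.
        refine ⟨_, Nat.le_ceil _, (Nat.ceil_lt_add_one (by positivity)).le.trans ?_⟩
        have e : 40 * a * (1 / (1 / (4 * L) * μ) * l) = 160 * (a * l * (L / μ)) := by
          field_simp; ring
        rw [e]; linarith
      have hX0 : 0 ≤ b * (√χ * X * l) := by positivity
      obtain ⟨H, hH1, hH2⟩ : ∃ H : ℕ, (M = 1 ∨ 40 * b * (√χ * X * l) ≤ H) ∧
          (H : ℝ) ≤ 44 * (b * (√χ * X * l)) := by
        -- For one node `√χ` may be arbitrarily small, so rounding up could break the bound; `H = 0`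
        -- is enough there.
        by_cases hM1 : M = 1
        · exact ⟨0, Or.inl hM1, by rw [Nat.cast_zero]; positivity⟩
        · refine ⟨_, Or.inr (Nat.le_ceil _),
            (Nat.ceil_lt_add_one (by positivity)).le.trans ?_⟩
          have h1 : 1 ≤ √χ * X := one_le_mul_of_one_le_of_one_le (hχ hM1) hX1
          have h2 : 0.69 ≤ √χ * X * l := by nlinarith
          have h3 : 0.47 ≤ b * (√χ * X * l) := by nlinarith
          linarith
      refine ⟨H, N, ?_, ?_, ?_, ?_⟩
      · linarith
      · exact hmain _ H N hμL (by positivity) le_rfl hH1 hN1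
      · rw [hrounds]
        calc 2 * (N : ℝ) * H ≤ 2 * (164 * (a * l * (L / μ))) * (44 * (b * (√χ * X * l))) := by
              gcongr
          _ = _ := by ring
      · rw [hcalls]
        have h0 : 14432 * a * (L / μ * l) = 14432 * (a * l * (L / μ)) := by ring
        rw [h0]; linarith
  · push Not at hsub
    have hall : ∀ γ H N, IsEpsSolution zs ε (desm P G lmin lmax γ H z₀ N).z := fun γ H N =>
      isEpsSolution_of_forall_eq hM hε fun m =>
        hsub _ (method_mem (hP.isProj_proj hz₀) _ _ _ _ _ _ hz₀ _ m)
    refine ⟨fun γ H N _ _ _ _ => hall γ H N, 0, 0, ?_, hall _ _ _, ?_, ?_⟩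
    · rw [Nat.cast_zero]; positivity
    · rw [hrounds, Nat.cast_zero]; simp only [mul_zero]; positivity
    · rw [hcalls, Nat.cast_zero, mul_zero]; positivity
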